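/- **Proposition 3.1.** Let $p\ge 1$ be an integer, $0<H_i<1$ $(i=1,\dots,p)$, $H=\mathrm{diag}(H_1,\dots,H_p)$, and let $A_+=(a^+_{ij})$, $A_-=(a^-_{ij})$ be real $p\times p$ matrices. Let $W=(W_1,\dots,W_p)$ be a Gaussian white noise on $\mathbb R$ with zero mean, independent components and covariance $\mathrm E\,W_i(\mathrm dx)W_j(\mathrm dx)=\delta_{ij}\,\mathrm dx$, i.e. a centered jointly Gaussian family with $\mathrm E\,W_i(A)W_j(B)=\delta_{ij}|A\cap B|$ for Borel sets $A,B$ of finite Lebesgue measure. Let $$X(t)=\int_{\mathbb R}\Big\{\big((t-x)_+^{H-1/2}-(-x)_+^{H-1/2}\big)A_+ +\big((t-x)_-^{H-1/2}-(-x)_-^{H-1/2}\big)A_-\Big\}\,W(\mathrm dx),\qquad t\in\mathbb R,$$ a Wiener integral, where $x_+=\max(x,0)$, $x_-=\max(-x,0)$, powers of the diagonal matrix $H-\frac12$ are taken entrywise on the diagonal, and $0^{a}:=0$ for every real $a$ (so $x_\pm^{0}=\mathbf 1_{\{\pm x>0\}}$). Put $$\alpha^{++}_{ij}=(A_+A_+^{*})_{ij},\quad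 \alpha^{--}_{ij}=(A_-A_-^{*})_{ij},\quad \alpha^{+-}_{ij}=(A_+A_-^{*})_{ij},\quad \alpha^{-+}_{ij}=(A_-A_+^{*})_{ij},$$ where $^*$ is the transpose, let $B(\cdot,\cdot)$ be the Beta function, and $\sigma_i=\sqrt{\mathrm{var}(X_i(1))}\ge 0$. Then the integrals exist, $X$ is a centered process with finite second moments, and: (i) For every $i$, $$\sigma_i^2=\frac{B(H_i+\frac12,H_i+\frac12)}{\sin(H_i\pi)}\Big\{\alpha^{++}_{ii}+\alpha^{--}_{ii}-2\sin(H_i\pi)\,\alpha^{+-}_{ii}\Big\}.$$ (ii) There are real numbers $c_{ij}$ such that, whenever $H_i+H_j\neq1$, $$\frac{\sigma_i\sigma_j}{2}\,c_{ij}=\frac{B(H_i+\frac12,H_j+\frac12)}{\sin((H_i+H_j)\pi)}\Big\{\alpha^{++}_{ij}\cos(H_i\pi)+\alpha^{--}_{ij}\cos(H_j\pi)-\alpha^{+-}_{ij}\sin((H_i+H_j)\pi)\Big\}$$ and, for all $s,t\in\mathbb R$, $$\mathrm E\,X_i(s)X_j(t)=\frac{\sigma_i\sigma_j}{2}\Big\{c_{ij}(s)|s|^{H_i+H_j}+c_{ji}(t)|t|^{H_i+H_j}-c_{ji}(t-s)|t-s|^{H_i+H_j}\Big\},$$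 where $c_{ij}(t)=c_{ij}$ for $t>0$ and $c_{ij}(t)=c_{ji}$ for $t<0$ (the value at $t=0$ is immaterial). (iii) There are real numbers $d_{ij},f_{ij}$ such that, whenever $H_i+H_j=1$, $$\sigma_i\sigma_j\,d_{ij}=B(H_i+\tfrac12,H_j+\tfrac12)\Big\{\frac{\sin(H_i\pi)+\sin(H_j\pi)}{2}\big(\alpha^{++}_{ij}+\alpha^{--}_{ij}\big)-\alpha^{+-}_{ij}-\alpha^{-+}_{ij}\Big\},$$ $$\sigma_i\sigma_j\,f_{ij}=(H_j-H_i)\big(\alpha^{++}_{ij}-\alpha^{--}_{ij}\big)$$ and, for all $s,t\in\mathbb R$, with $0\log 0:=0$, $$\mathrm E\,X_i(s)X_j(t)=\frac{\sigma_i\sigma_j}{2}\Big\{d_{ij}\big(|s|+|t|-|s-t|\big)+f_{ij}\big(t\log|t|-s\log|s|-(t-s)\log|t-s|\big)\Big\}.$$ -/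

import Mathlib

open MeasureTheory ProbabilityTheory Filter

noncomputable section

namespace VFBM

/-- A Borel set of finite Lebesgue measure on the line. -/
abbrev FinBorel : Type := {A : Set ℝ // MeasurableSet A ∧ volume A < ⊤}

/-- `W = (W_1, …, W_p)` is a Gaussian white noise on the line with zero mean, independent components
and covariance `E W_i(dx) W_j(dx) = δ_ij dx`: a centered, jointly Gaussian family indexed by the
components and the Borel sets of finite measure, with `E W_i(A) W_j(B) = δ_ij |A ∩ B|`.
(For a jointly Gaussian family, independence of the components is their being uncorrelated.) -/
structure IsGaussianWhiteNoise {Ω : Type*} [MeasurableSpace Ω] (P : Measure Ω) {p : ℕ}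
    (W : Fin p → Set ℝ → Ω → ℝ) : Prop where
  gaussian : IsGaussianProcess (fun q : Fin p × FinBorel => W q.1 q.2.1) P
  mean_zero : ∀ (i : Fin p) (A : FinBorel), ∫ ω, W i A.1 ω ∂P = 0
  covariance : ∀ (i j : Fin p) (A B : FinBorel),
    ∫ ω, W i A.1 ω * W j B.1 ω ∂P = if i = j then volume.real (A.1 ∩ B.1) else 0

/-- The integral `∑ c W(φ = c)`, over the nonzero values `c` of `φ`, of a simple function. -/
def simpleIntegral {Ω : Type*} (w : Set ℝ → Ω → ℝ) (φ : SimpleFunc ℝ ℝ) (ω : Ω) : ℝ :=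
  ∑ c ∈ φ.range with c ≠ 0, c * w (φ ⁻¹' {c}) ω

/-- `Y` is a version of the Wiener integral `∫ f(x) w(dx)`: the `L²(P)`-limit of the integrals of
simple functions that converge to `f` in `L²(ℝ)`. -/
def IsWienerIntegral {Ω : Type*} [MeasurableSpace Ω] (P : Measure Ω) (w : Set ℝ → Ω → ℝ)
    (f : ℝ → ℝ) (Y : Ω → ℝ) : Prop :=
  MemLp f 2 volume ∧ MemLp Y 2 P ∧
    ∃ φ : ℕ → SimpleFunc ℝ ℝ, (∀ n, (φ n).FinMeasSupp volume) ∧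
      Tendsto (fun n => eLpNorm (fun x => φ n x - f x) 2 volume) atTop (nhds 0) ∧
      Tendsto (fun n => eLpNorm (fun ω => simpleIntegral w (φ n) ω - Y ω) 2 P) atTop (nhds 0)

open Classical in
/-- The Wiener integral `∫ f(x) w(dx)`, as a chosen version (and `0` if there is none). -/
def wienerIntegral {Ω : Type*} [MeasurableSpace Ω] (P : Measure Ω) (w : Set ℝ → Ω → ℝ)
    (f : ℝ → ℝ) : Ω → ℝ :=
  if h : ∃ Y, IsWienerIntegral P w f Y then h.choose else 0

/-- `y_+ ^ a`, equal to `0` for `y ≤ 0` (also when `a = 0`, where `y_+ ^ 0` is the indicator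
of `y > 0`). -/
def posPow (y a : ℝ) : ℝ := if 0 < y then y ^ a else 0

/-- `y_- ^ a`, where `y_- = (-y)_+`. -/
def negPow (y a : ℝ) : ℝ := posPow (-y) a

/-- The matrix kernel
`((t-x)_+^(H-1/2) - (-x)_+^(H-1/2)) A_+ + ((t-x)_-^(H-1/2) - (-x)_-^(H-1/2)) A_-`,
with `H = diag(H_1, …, H_p)`. -/
def kernel {p : ℕ} (H : Fin p → ℝ) (Ap Am : Matrix (Fin p) (Fin p) ℝ) (t x : ℝ) :
    Matrix (Fin p) (Fin p) ℝ :=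
  Matrix.diagonal (fun i => posPow (t - x) (H i - 1 / 2) - posPow (-x) (H i - 1 / 2)) * Ap +
    Matrix.diagonal (fun i => negPow (t - x) (H i - 1 / 2) - negPow (-x) (H i - 1 / 2)) * Am

/-- The `i`-th component of `∫ kernel(t, x) W(dx)`. -/
def vfbm {Ω : Type*} [MeasurableSpace Ω] (P : Measure Ω) {p : ℕ} (W : Fin p → Set ℝ → Ω → ℝ)
    (H : Fin p → ℝ) (Ap Am : Matrix (Fin p) (Fin p) ℝ) (i : Fin p) (t : ℝ) (ω : Ω) : ℝ :=
  ∑ k, wienerIntegral P (W k) (fun x => kernel H Ap Am t x i k) ω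

/-- `c_ij(t)`: `c_ij` for `t > 0` and `c_ji` for `t < 0` (the value at `0` is only ever multiplied
by `0`). -/
def signCoef {p : ℕ} (c : Matrix (Fin p) (Fin p) ℝ) (i j : Fin p) (t : ℝ) : ℝ :=
  if 0 < t then c i j else c j i

end VFBM

end

/-! The Itô isometry, checked on simple functions and passed to `L²` limits, turns the covariance
into deterministic inner products: `E X_i(s) X_j(t)` is the sum over `k` of the integrals of
products of kernel entries. With `a = H_i - 1/2` and `b = H_j - 1/2`, each entry combines the scalar
increment `incr a t x` and its reflection `incr a (-t) (-x)`, so four scalar integrals remain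
(`sum_integral_kernel_mul_kernel`).

The two mixed integrals have products supported on bounded intervals and are Beta integrals
(`integral_incr_mul_incr_reflect`). The two unmixed ones agree up to `x ↦ -x`. In `∫ incr a s x *
incr b t x` the four products need not be integrable separately at `-∞`, so the line is cut at `-N`.
Each truncated product equals a divergent part, a constant plus a linear function of `(s, t)`, plus
a limit homogeneous of degree `a + b + 1` in `t - s` (`tendsto_truncProd`). The divergent parts
cancel in the mixed second difference (`integral_incr_mul_incr`); Gamma reflection gives the
trigonometric coefficients.

The formula degenerates when `a + b = 0`, that is `H_i + H_j = 1`. There it is obtained by letting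
`b → -a`: dominated convergence on the integral side, derivatives of 0/0 quotients on the other,
which produce the logarithms (`integral_incr_mul_incr_neg_exponent`).

Dividing by `σ_i σ_j` is harmless: if `σ_i = 0` then `X_i(1) = 0` almost surely, and evaluating the
covariance at `t = 1, 2` forces the coefficients to vanish. -/

noncomputable section

namespace VFBM

open Topology

/-! ### Inner products and limits in `L²` -/

section L2

variable {α : Type*} [MeasurableSpace α] {μ : Measure α}

lemma inner_toLp_eq_integral_mul {f g : α → ℝ} (hf : MemLp f 2 μ) (hg : MemLp g 2 μ) :
    inner ℝ (hf.toLp f) (hg.toLp g) = ∫ x, f x * g x ∂μ := by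
  rw [L2.inner_def]
  refine integral_congr_ae ?_
  filter_upwards [hf.coeFn_toLp, hg.coeFn_toLp] with x h1 h2
  simp [h1, h2, mul_comm]

lemma integrable_mul_of_memLp_two {f g : α → ℝ} (hf : MemLp f 2 μ) (hg : MemLp g 2 μ) :
    Integrable (fun x => f x * g x) μ :=
  hf.integrable_mul hg

lemma dist_toLp_sq {f g : α → ℝ} (hf : MemLp f 2 μ) (hg : MemLp g 2 μ) :
    dist (hf.toLp f) (hg.toLp g) ^ 2
      = ∫ x, f x * f x ∂μ - 2 * ∫ x, f x * g x ∂μ + ∫ x, g x * g x ∂μ := by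
  rw [dist_eq_norm, @norm_sub_sq_real, ← real_inner_self_eq_norm_sq, ← real_inner_self_eq_norm_sq,
    inner_toLp_eq_integral_mul, inner_toLp_eq_integral_mul, inner_toLp_eq_integral_mul]

lemma tendsto_integral_mul_of_tendsto_eLpNorm {f g : ℕ → α → ℝ} {f₀ g₀ : α → ℝ}
    (hf : ∀ n, MemLp (f n) 2 μ) (hg : ∀ n, MemLp (g n) 2 μ)
    (hf₀ : MemLp f₀ 2 μ) (hg₀ : MemLp g₀ 2 μ)
    (hfl : Tendsto (fun n => eLpNorm (fun x => f n x - f₀ x) 2 μ) atTop (𝓝 0))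
    (hgl : Tendsto (fun n => eLpNorm (fun x => g n x - g₀ x) 2 μ) atTop (𝓝 0)) :
    Tendsto (fun n => ∫ x, f n x * g n x ∂μ) atTop (𝓝 (∫ x, f₀ x * g₀ x ∂μ)) := by
  have h1 := (Lp.tendsto_Lp_iff_tendsto_eLpNorm'' f hf f₀ hf₀).2 hfl
  have h2 := (Lp.tendsto_Lp_iff_tendsto_eLpNorm'' g hg g₀ hg₀).2 hgl
  have := h1.inner (𝕜 := ℝ) h2
  simpa only [inner_toLp_eq_integral_mul] using this

end L2

/-- With indicators in place of the noise, a simple function is its own integral. One bilinear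
expansion thus serves both `E` of a product of noise integrals and `∫ φ ψ`, and the isometry follows
by comparing terms. -/
lemma simpleIntegral_indicator (φ : SimpleFunc ℝ ℝ) (x : ℝ) :
    simpleIntegral (fun A => A.indicator 1) φ x = φ x := by
  unfold simpleIntegral
  by_cases hx : φ x = 0
  · rw [hx]
    refine Finset.sum_eq_zero fun c hc => ?_
    rw [Finset.mem_filter] at hc
    have : x ∉ φ ⁻¹' {c} := fun h => hc.2 (by rw [← hx]; exact h.symm)
    simp [Set.indicator_of_notMem this]
  · rw [Finset.sum_eq_single (φ x)]
    · have : x ∈ φ ⁻¹' {φ x} := rfl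
      simp
    · intro c _ hc
      have : x ∉ φ ⁻¹' {c} := fun h => hc (Set.mem_singleton_iff.1 h).symm
      simp [Set.indicator_of_notMem this]
    · intro h
      exact absurd (by simp [hx]) h

/-- Bilinearity of the second moments of integrals of simple functions. -/
lemma integral_simpleIntegral_mul {α : Type*} [MeasurableSpace α] {μ : Measure α}
    (v w : Set ℝ → α → ℝ) (φ ψ : SimpleFunc ℝ ℝ)
    (hv : ∀ c, c ≠ 0 → MemLp (v (φ ⁻¹' {c})) 2 μ) (hw : ∀ c, c ≠ 0 → MemLp (w (ψ ⁻¹' {c})) 2 μ) :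
    ∫ ω, simpleIntegral v φ ω * simpleIntegral w ψ ω ∂μ
      = ∑ c ∈ φ.range with c ≠ 0, ∑ d ∈ ψ.range with d ≠ 0,
          c * d * ∫ ω, v (φ ⁻¹' {c}) ω * w (ψ ⁻¹' {d}) ω ∂μ := by
  unfold simpleIntegral
  simp_rw [Finset.sum_mul_sum]
  have hI : ∀ c ∈ φ.range.filter (· ≠ 0), ∀ d ∈ ψ.range.filter (· ≠ 0),
      Integrable (fun ω => c * v (φ ⁻¹' {c}) ω * (d * w (ψ ⁻¹' {d}) ω)) μ := by
    intro c hc d hd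
    exact integrable_mul_of_memLp_two ((hv c (Finset.mem_filter.1 hc).2).const_mul c)
      ((hw d (Finset.mem_filter.1 hd).2).const_mul d)
  rw [integral_finsetSum _ fun c hc => integrable_finsetSum _ fun d hd => hI c hc d hd]
  refine Finset.sum_congr rfl fun c hc => ?_
  rw [integral_finsetSum _ fun d hd => hI c hc d hd]
  refine Finset.sum_congr rfl fun d hd => ?_
  rw [← integral_const_mul]
  congr 1 with ω
  ring

lemma memLp_indicator_preimage {φ : SimpleFunc ℝ ℝ} (hφ : φ.FinMeasSupp volume) {c : ℝ}
    (hc : c ≠ 0) : MemLp ((φ ⁻¹' {c}).indicator (1 : ℝ → ℝ)) 2 volume :=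
  memLp_indicator_const 2 (φ.measurableSet_fiber c) (1 : ℝ)
    (Or.inr (hφ.meas_preimage_singleton_ne_zero hc).ne)

lemma integral_simpleFunc_mul {φ ψ : SimpleFunc ℝ ℝ} (hφ : φ.FinMeasSupp volume)
    (hψ : ψ.FinMeasSupp volume) :
    ∫ x, φ x * ψ x = ∑ c ∈ φ.range with c ≠ 0, ∑ d ∈ ψ.range with d ≠ 0,
      c * d * volume.real (φ ⁻¹' {c} ∩ ψ ⁻¹' {d}) := by
  have := integral_simpleIntegral_mul (μ := volume) (fun A => A.indicator (1 : ℝ → ℝ))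
    (fun A => A.indicator (1 : ℝ → ℝ)) φ ψ (fun c hc => memLp_indicator_preimage hφ hc)
    (fun c hc => memLp_indicator_preimage hψ hc)
  simp_rw [simpleIntegral_indicator] at this
  rw [this]
  refine Finset.sum_congr rfl fun c _ => Finset.sum_congr rfl fun d _ => ?_
  congr 1
  rw [← integral_indicator_one ((φ.measurableSet_fiber c).inter (ψ.measurableSet_fiber d))]
  congr 1 with x
  rw [Set.inter_indicator_one]
  rfl

lemma memLp_two_simpleFunc {φ : SimpleFunc ℝ ℝ} (hφ : φ.FinMeasSupp volume) :
    MemLp φ 2 volume :=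
  (SimpleFunc.memLp_iff_finMeasSupp (by simp) (by simp)).2 hφ

/-! ### Wiener integrals and the Itô isometry -/

section WhiteNoise

variable {Ω : Type*} [MeasurableSpace Ω] {P : Measure Ω} {p : ℕ} {W : Fin p → Set ℝ → Ω → ℝ}

lemma IsGaussianWhiteNoise.memLp (hW : IsGaussianWhiteNoise P W) (i : Fin p) {A : Set ℝ}
    (hA : MeasurableSet A) (hA' : volume A < ⊤) : MemLp (W i A) 2 P :=
  (hW.gaussian.hasGaussianLaw_eval (i, (⟨A, hA, hA'⟩ : FinBorel))).memLp_two

lemma IsGaussianWhiteNoise.memLp_preimage (hW : IsGaussianWhiteNoise P W) (i : Fin p)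
    {φ : SimpleFunc ℝ ℝ} (hφ : φ.FinMeasSupp volume) {c : ℝ} (hc : c ≠ 0) :
    MemLp (W i (φ ⁻¹' {c})) 2 P :=
  hW.memLp i (φ.measurableSet_fiber c) (hφ.meas_preimage_singleton_ne_zero hc)

lemma IsGaussianWhiteNoise.memLp_simpleIntegral (hW : IsGaussianWhiteNoise P W) (i : Fin p)
    {φ : SimpleFunc ℝ ℝ} (hφ : φ.FinMeasSupp volume) :
    MemLp (simpleIntegral (W i) φ) 2 P := by
  refine memLp_finsetSum _ fun c hc => ?_
  exact (hW.memLp_preimage i hφ (Finset.mem_filter.1 hc).2).const_mul c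

lemma IsGaussianWhiteNoise.integral_simpleIntegral [IsFiniteMeasure P]
    (hW : IsGaussianWhiteNoise P W) (i : Fin p)
    {φ : SimpleFunc ℝ ℝ} (hφ : φ.FinMeasSupp volume) :
    ∫ ω, simpleIntegral (W i) φ ω ∂P = 0 := by
  unfold simpleIntegral
  rw [integral_finsetSum]
  · refine Finset.sum_eq_zero fun c hc => ?_
    rw [integral_const_mul, hW.mean_zero i ⟨φ ⁻¹' {c}, φ.measurableSet_fiber c,
      hφ.meas_preimage_singleton_ne_zero (Finset.mem_filter.1 hc).2⟩, mul_zero]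
  · intro c hc
    exact ((hW.memLp_preimage i hφ (Finset.mem_filter.1 hc).2).integrable
      one_le_two).const_mul c

lemma IsGaussianWhiteNoise.integral_simpleIntegral_mul (hW : IsGaussianWhiteNoise P W)
    (i j : Fin p) {φ ψ : SimpleFunc ℝ ℝ} (hφ : φ.FinMeasSupp volume)
    (hψ : ψ.FinMeasSupp volume) :
    ∫ ω, simpleIntegral (W i) φ ω * simpleIntegral (W j) ψ ω ∂P
      = if i = j then ∫ x, φ x * ψ x else 0 := by
  rw [VFBM.integral_simpleIntegral_mul _ _ φ ψ (fun c hc => hW.memLp_preimage i hφ hc)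
    (fun c hc => hW.memLp_preimage j hψ hc), integral_simpleFunc_mul hφ hψ]
  have hcov : ∀ c ∈ φ.range.filter (· ≠ 0), ∀ d ∈ ψ.range.filter (· ≠ 0),
      ∫ ω, W i (φ ⁻¹' {c}) ω * W j (ψ ⁻¹' {d}) ω ∂P
        = if i = j then volume.real (φ ⁻¹' {c} ∩ ψ ⁻¹' {d}) else 0 := fun c hc d hd =>
    hW.covariance i j ⟨φ ⁻¹' {c}, φ.measurableSet_fiber c,
      hφ.meas_preimage_singleton_ne_zero (Finset.mem_filter.1 hc).2⟩
      ⟨ψ ⁻¹' {d}, ψ.measurableSet_fiber d,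
      hψ.meas_preimage_singleton_ne_zero (Finset.mem_filter.1 hd).2⟩
  rw [Finset.sum_congr rfl fun c hc => Finset.sum_congr rfl fun d hd => by rw [hcov c hc d hd]]
  split_ifs <;> simp

/-- A square integrable function has a Wiener integral. -/
lemma IsGaussianWhiteNoise.exists_isWienerIntegral (hW : IsGaussianWhiteNoise P W) (i : Fin p)
    {f : ℝ → ℝ} (hf : MemLp f 2 volume) : ∃ Y, IsWienerIntegral P (W i) f Y := by
  have hφ : ∀ n : ℕ, ∃ φ : SimpleFunc ℝ ℝ, eLpNorm (f - ⇑φ) 2 volume < ((n : ENNReal) + 1)⁻¹ ∧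
      MemLp φ 2 volume := fun n =>
    hf.exists_simpleFunc_eLpNorm_sub_lt (by simp) (by simp)
  choose φ hφ hφL using hφ
  have hfin : ∀ n, (φ n).FinMeasSupp volume := fun n =>
    (SimpleFunc.memLp_iff_finMeasSupp (by simp) (by simp)).1 (hφL n)
  have hlim : Tendsto (fun n => eLpNorm (fun x => φ n x - f x) 2 volume) atTop (𝓝 0) := by
    have h0 : Tendsto (fun n : ℕ => ((n : ENNReal) + 1)⁻¹) atTop (𝓝 0) := by
      have := (tendsto_add_atTop_iff_nat 1).2 ENNReal.tendsto_inv_nat_nhds_zero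
      simpa using this
    refine tendsto_of_tendsto_of_tendsto_of_le_of_le tendsto_const_nhds h0 (fun _ => zero_le)
      fun n => ?_
    refine le_trans (le_of_eq ?_) (hφ n).le
    rw [← eLpNorm_neg]
    congr 1 with x
    simp
  have hconv := (Lp.tendsto_Lp_iff_tendsto_eLpNorm'' (fun n => ⇑(φ n))
    (fun n => memLp_two_simpleFunc (hfin n)) f hf).2 hlim
  have hS := fun n => hW.memLp_simpleIntegral i (hfin n)
  -- The isometry on simple functions: the integrals inherit the Cauchy property from the
  -- approximants.
  have hdist : ∀ m n, dist ((hS m).toLp _) ((hS n).toLp _)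
      = dist ((memLp_two_simpleFunc (hfin m)).toLp _)
          ((memLp_two_simpleFunc (hfin n)).toLp _) := by
    intro m n
    refine (sq_eq_sq₀ dist_nonneg dist_nonneg).1 ?_
    rw [dist_toLp_sq, dist_toLp_sq]
    simp [hW.integral_simpleIntegral_mul i i (hfin _) (hfin _)]
  have hcau : CauchySeq fun n => (hS n).toLp (simpleIntegral (W i) (φ n)) := by
    have := hconv.cauchySeq
    rw [cauchySeq_iff_tendsto_dist_atTop_0] at this ⊢
    simpa only [hdist] using this
  obtain ⟨Y, hY⟩ := cauchySeq_tendsto_of_complete hcau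
  refine ⟨Y, hf, Lp.memLp Y, φ, hfin, hlim, ?_⟩
  rw [← Lp.toLp_coeFn Y (Lp.memLp Y)] at hY
  exact (Lp.tendsto_Lp_iff_tendsto_eLpNorm'' _ hS _ (Lp.memLp Y)).1 hY

lemma isWienerIntegral_wienerIntegral {w : Set ℝ → Ω → ℝ} {f : ℝ → ℝ}
    (h : ∃ Y, IsWienerIntegral P w f Y) : IsWienerIntegral P w f (wienerIntegral P w f) := by
  rw [wienerIntegral, dif_pos h]
  exact h.choose_spec

/-- Second moments are continuous in `L²`, so the isometry survives the limit. It holds for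
arbitrary versions, which makes the choice in `wienerIntegral` immaterial. -/
lemma IsGaussianWhiteNoise.integral_mul_of_isWienerIntegral (hW : IsGaussianWhiteNoise P W)
    {i j : Fin p} {f g : ℝ → ℝ} {Y Z : Ω → ℝ} (hY : IsWienerIntegral P (W i) f Y)
    (hZ : IsWienerIntegral P (W j) g Z) :
    ∫ ω, Y ω * Z ω ∂P = if i = j then ∫ x, f x * g x else 0 := by
  obtain ⟨hf, hYL, φ, hφ, hφf, hφY⟩ := hY
  obtain ⟨hg, hZL, ψ, hψ, hψg, hψZ⟩ := hZ
  have h1 := tendsto_integral_mul_of_tendsto_eLpNorm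
    (fun n => hW.memLp_simpleIntegral i (hφ n)) (fun n => hW.memLp_simpleIntegral j (hψ n))
    hYL hZL hφY hψZ
  have h2 := tendsto_integral_mul_of_tendsto_eLpNorm
    (fun n => memLp_two_simpleFunc (hφ n)) (fun n => memLp_two_simpleFunc (hψ n)) hf hg hφf hψg
  simp_rw [hW.integral_simpleIntegral_mul i j (hφ _) (hψ _)] at h1
  split_ifs with hij
  · simp only [hij, if_true] at h1
    exact tendsto_nhds_unique h1 h2
  · simp only [hij, if_false] at h1
    exact tendsto_nhds_unique h1 tendsto_const_nhds

lemma IsGaussianWhiteNoise.integral_of_isWienerIntegral [IsFiniteMeasure P]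
    (hW : IsGaussianWhiteNoise P W)
    {i : Fin p} {f : ℝ → ℝ} {Y : Ω → ℝ} (hY : IsWienerIntegral P (W i) f Y) :
    ∫ ω, Y ω ∂P = 0 := by
  obtain ⟨hf, hYL, φ, hφ, hφf, hφY⟩ := hY
  -- The mean is the pairing with the constant 1, which is in `L²` because `P` is finite.
  have h1 := tendsto_integral_mul_of_tendsto_eLpNorm (g := fun _ _ => 1) (g₀ := fun _ => 1)
    (fun n => hW.memLp_simpleIntegral i (hφ n)) (fun n => memLp_const 1)
    hYL (memLp_const 1) hφY (by simp)
  simp only [mul_one, hW.integral_simpleIntegral i (hφ _)] at h1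
  exact tendsto_nhds_unique h1 tendsto_const_nhds

end WhiteNoise

open Set

/-! ### Asymptotics of products of shifted powers -/

section Asymptotics

lemma exists_rpow_mul_rpow_taylor_bound (s t α β : ℝ) :
    ∃ ε > 0, ∃ C, ∀ x ∈ Icc 0 ε,
      |(1 + s * x) ^ α * (1 + t * x) ^ β - 1 - (α * s + β * t) * x| ≤ C * x ^ 2 := by
  -- This radius keeps `|s x|` and `|t x|` at most 1/2, so both bases stay positive and the product
  -- is smooth.
  set ε : ℝ := 1 / (2 * (|s| + |t| + 1)) with hε
  have hd : 0 < 2 * (|s| + |t| + 1) := by positivity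
  have hε0 : 0 < ε := by positivity
  have hpos : ∀ r : ℝ, |r| ≤ |s| + |t| → ∀ x ∈ Icc 0 ε, 0 < 1 + r * x := by
    intro r hr x hx
    have h1 : |r * x| ≤ 1 / 2 := by
      rw [abs_mul, abs_of_nonneg hx.1]
      calc |r| * x ≤ (|s| + |t|) * ε := by
            exact mul_le_mul hr hx.2 hx.1 (by positivity)
        _ ≤ 1 / 2 := by
            rw [hε, mul_one_div, div_le_iff₀ hd]
            linarith
    linarith [neg_abs_le (r * x)]
  have hs := hpos s (by linarith [abs_nonneg t])
  have ht := hpos t (by linarith [abs_nonneg s])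
  set g : ℝ → ℝ := fun x => (1 + s * x) ^ α * (1 + t * x) ^ β with hg
  have hC : ContDiffOn ℝ ((1 : ℕ) + 1) g (Icc 0 ε) := by
    refine ContDiffOn.mul ?_ ?_
    · exact ContDiffOn.rpow_const_of_ne (by fun_prop) fun x hx => (hs x hx).ne'
    · exact ContDiffOn.rpow_const_of_ne (by fun_prop) fun x hx => (ht x hx).ne'
  obtain ⟨C, hC⟩ := exists_taylor_mean_remainder_bound hε0.le hC
  refine ⟨ε, hε0, C, fun x hx => ?_⟩
  have hderiv : HasDerivAt g (α * s + β * t) 0 := by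
    have h1 : ∀ r γ : ℝ, HasDerivAt (fun x : ℝ => (1 + r * x) ^ γ) (γ * r) 0 := by
      intro r γ
      have h := ((hasDerivAt_id (0 : ℝ)).const_mul r).const_add 1
      have h2 := h.rpow_const (p := γ) (Or.inl (by simp))
      simpa [mul_comm] using h2
    exact ((h1 s α).mul (h1 t β)).congr_deriv (by simp)
  have h0 : (0 : ℝ) ∈ Icc 0 ε := ⟨le_rfl, hε0.le⟩
  have hdw : derivWithin g (Icc 0 ε) 0 = α * s + β * t :=
    hderiv.hasDerivWithinAt.derivWithin (uniqueDiffOn_Icc hε0 0 h0)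
  have := hC x hx
  rw [taylorWithinEval_succ, taylor_within_zero_eval, iteratedDerivWithin_one, hdw] at this
  have hg0 : g 0 = 1 := by simp [hg]
  rw [hg0, Real.norm_eq_abs] at this
  simp only [sub_zero] at this
  convert this using 2
  simp
  ring

/-- Factor out `N ^ (α + β)` and apply the Taylor bound at `x = 1 / N`: the error is `O(N ^ (α + β -
2))`. -/
lemma tendsto_shifted_rpow_mul_sub_two {α β : ℝ} (h : α + β < 2) (s t : ℝ) :
    Tendsto (fun N : ℝ => (N + s) ^ α * (N + t) ^ β - N ^ (α + β)
      - (α * s + β * t) * N ^ (α + β - 1)) atTop (𝓝 0) := by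
  obtain ⟨ε, hε, C, hC⟩ := exists_rpow_mul_rpow_taylor_bound s t α β
  have hlim : Tendsto (fun N : ℝ => C * N ^ (α + β - 2)) atTop (𝓝 0) := by
    have := (tendsto_rpow_neg_atTop (y := 2 - (α + β)) (by linarith)).const_mul C
    simpa using this
  refine squeeze_zero_norm' ?_ hlim
  filter_upwards [eventually_ge_atTop (1 / ε), eventually_gt_atTop 0,
    eventually_ge_atTop (-s), eventually_ge_atTop (-t)] with N hN hN0 hs ht
  have hx : 1 / N ∈ Icc 0 ε := ⟨by positivity, by
    rw [div_le_iff₀ hN0]; rw [div_le_iff₀ hε] at hN; linarith⟩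
  have hb := hC _ hx
  have e1 : ∀ r γ : ℝ, -r ≤ N → (N + r) ^ γ = N ^ γ * (1 + r * (1 / N)) ^ γ := by
    intro r γ hr
    rw [← Real.mul_rpow hN0.le]
    · congr 1
      field_simp
    · have : 1 + r * (1 / N) = (N + r) / N := by field_simp
      rw [this]
      exact div_nonneg (by linarith) hN0.le
  rw [e1 s α hs, e1 t β ht]
  have e2 : N ^ (α + β - 1) = N ^ (α + β) * (1 / N) := by
    rw [Real.rpow_sub_one hN0.ne']; ring
  have e3 : N ^ (α + β - 2) = N ^ (α + β) * (1 / N) ^ 2 := by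
    rw [Real.rpow_sub hN0, Real.rpow_two]; field_simp
  have e4 : N ^ α * (1 + s * (1 / N)) ^ α * (N ^ β * (1 + t * (1 / N)) ^ β) - N ^ (α + β)
      - (α * s + β * t) * N ^ (α + β - 1)
      = N ^ (α + β) * ((1 + s * (1 / N)) ^ α * (1 + t * (1 / N)) ^ β - 1
        - (α * s + β * t) * (1 / N)) := by
    rw [e2, Real.rpow_add hN0]; ring
  rw [e4, e3, norm_mul, Real.norm_eq_abs, abs_of_nonneg (Real.rpow_nonneg hN0.le _),
    Real.norm_eq_abs]
  calc _ ≤ N ^ (α + β) * (C * (1 / N) ^ 2) := by gcongr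
    _ = _ := by ring

lemma tendsto_shifted_rpow_mul_sub {α β : ℝ} (h : α + β < 1) (s t : ℝ) :
    Tendsto (fun N : ℝ => (N + s) ^ α * (N + t) ^ β - N ^ (α + β)) atTop (𝓝 0) := by
  have h1 := tendsto_shifted_rpow_mul_sub_two (α := α) (β := β) (by linarith) s t
  have h2 := (tendsto_rpow_neg_atTop (y := 1 - (α + β)) (by linarith)).const_mul (α * s + β * t)
  have := h1.add h2
  simpa using this

end Asymptotics

/-! ### Beta integrals and the reflection formula -/

section Beta

lemma beta_comm (x y : ℝ) : beta x y = beta y x := by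
  unfold beta; rw [mul_comm, add_comm]

lemma intervalIntegral_rpow_mul_rpow_sub {a b c : ℝ} (ha : -1 < a) (hb : -1 < b) (hc : 0 < c) :
    ∫ x in 0..c, x ^ a * (c - x) ^ b = c ^ (a + b + 1) * beta (a + 1) (b + 1) := by
  have h := Complex.betaIntegral_scaled ((a + 1 : ℝ) : ℂ) ((b + 1 : ℝ) : ℂ) hc
  have hB : Complex.betaIntegral ((a + 1 : ℝ) : ℂ) ((b + 1 : ℝ) : ℂ)
      = ((beta (a + 1) (b + 1) : ℝ) : ℂ) := by
    rw [Complex.betaIntegral_eq_Gamma_mul_div _ _ (by simp; linarith) (by simp; linarith)]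
    simp only [beta]
    rw [← Complex.ofReal_add, Complex.Gamma_ofReal, Complex.Gamma_ofReal, Complex.Gamma_ofReal]
    push_cast
    rfl
  rw [hB] at h
  have hL : ∫ x in 0..c, (x : ℂ) ^ (((a + 1 : ℝ) : ℂ) - 1) * ((c : ℂ) - x) ^ (((b + 1 : ℝ) : ℂ) - 1)
      = ((∫ x in 0..c, x ^ a * (c - x) ^ b : ℝ) : ℂ) := by
    rw [← intervalIntegral.integral_ofReal]
    refine intervalIntegral.integral_congr fun x hx => ?_
    rw [uIcc_of_le hc.le] at hx
    rw [Complex.ofReal_mul, Complex.ofReal_cpow hx.1, Complex.ofReal_cpow (by linarith [hx.2])]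
    push_cast
    simp
  rw [hL] at h
  have hR : (c : ℂ) ^ (((a + 1 : ℝ) : ℂ) + ((b + 1 : ℝ) : ℂ) - 1)
      = ((c ^ (a + b + 1) : ℝ) : ℂ) := by
    rw [Complex.ofReal_cpow hc.le]
    congr 1
    push_cast
    ring
  rw [hR] at h
  exact_mod_cast h

lemma integrableOn_rpow_mul_one_sub_rpow {a b : ℝ} (ha : -1 < a) (hb : -1 < b) :
    IntegrableOn (fun x : ℝ => x ^ a * (1 - x) ^ b) (Ioo 0 1) := by
  have h := Complex.betaIntegral_convergent (u := ((a + 1 : ℝ) : ℂ)) (v := ((b + 1 : ℝ) : ℂ))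
    (by simp; linarith) (by simp; linarith)
  rw [intervalIntegrable_iff_integrableOn_Ioo_of_le zero_le_one] at h
  refine (integrableOn_congr_fun (fun x hx => ?_) measurableSet_Ioo).1 h.re
  have e : (x : ℂ) ^ (((a + 1 : ℝ) : ℂ) - 1) * (1 - (x : ℂ)) ^ (((b + 1 : ℝ) : ℂ) - 1)
      = ((x ^ a * (1 - x) ^ b : ℝ) : ℂ) := by
    rw [Complex.ofReal_mul, Complex.ofReal_cpow hx.1.le, Complex.ofReal_cpow (by linarith [hx.2])]
    push_cast
    simp
  simp only [e]
  exact RCLike.ofReal_re (K := ℂ) _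

/-- The substitution `u = δ w / (1 - w)` in the Beta integral. -/
lemma integral_Ioi_rpow_mul_add_rpow {a b δ : ℝ} (ha : -1 < a) (hab : a + b < -1) (hδ : 0 < δ) :
    IntegrableOn (fun u : ℝ => u ^ a * (u + δ) ^ b) (Ioi 0) ∧
      ∫ u in Ioi 0, u ^ a * (u + δ) ^ b = δ ^ (a + b + 1) * beta (a + 1) (-1 - a - b) := by
  set F : ℝ → ℝ := fun w => δ * w / (1 - w) with hF
  set F' : ℝ → ℝ := fun w => δ / (1 - w) ^ 2 with hF'
  have hd : ∀ w ∈ Ioo (0 : ℝ) 1, HasDerivWithinAt F (F' w) (Ioo 0 1) w := by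
    intro w hw
    have h1 : (1 - w) ≠ 0 := by linarith [hw.2]
    have := ((hasDerivAt_id w).const_mul δ).div ((hasDerivAt_id w).const_sub 1) h1
    refine (HasDerivAt.congr_deriv this ?_).hasDerivWithinAt
    simp only [hF', id]
    congr 1
    ring
  have hinj : InjOn F (Ioo 0 1) := by
    intro w hw z hz h
    have h1 : (1 - w) ≠ 0 := by linarith [hw.2]
    have h2 : (1 - z) ≠ 0 := by linarith [hz.2]
    simp only [hF] at h
    rw [div_eq_div_iff h1 h2] at h
    have : δ * (w - z) = 0 := by linarith
    rcases mul_eq_zero.1 this with h | h <;> linarith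
  have himg : F '' Ioo 0 1 = Ioi 0 := by
    ext u
    constructor
    · rintro ⟨w, hw, rfl⟩
      have : 0 < 1 - w := by linarith [hw.2]
      exact div_pos (mul_pos hδ hw.1) this
    · intro hu
      have hu : 0 < u := hu
      have h3 : 0 < u + δ := by linarith
      refine ⟨u / (u + δ), ⟨by positivity, by rw [div_lt_one h3]; linarith⟩, ?_⟩
      simp only [hF]
      have : 1 - u / (u + δ) = δ / (u + δ) := by field_simp; ring
      rw [this]
      field_simp
  have hcongr : ∀ w ∈ Ioo (0 : ℝ) 1, |F' w| • ((F w) ^ a * (F w + δ) ^ b)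
      = δ ^ (a + b + 1) * (w ^ a * (1 - w) ^ (-2 - a - b)) := by
    intro w hw
    have h1 : 0 < 1 - w := by linarith [hw.2]
    have h2 : F w + δ = δ / (1 - w) := by simp only [hF]; field_simp; ring
    have h3 : 0 < F' w := by positivity
    rw [abs_of_pos h3, h2, smul_eq_mul]
    simp only [hF, hF']
    rw [Real.div_rpow (mul_pos hδ hw.1).le h1.le, Real.div_rpow hδ.le h1.le,
      Real.mul_rpow hδ.le hw.1.le, Real.rpow_add_one hδ.ne', Real.rpow_add hδ,
      Real.rpow_sub h1, Real.rpow_sub h1, Real.rpow_neg h1.le, Real.rpow_two]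
    have := (Real.rpow_pos_of_pos h1 a).ne'
    have := (Real.rpow_pos_of_pos h1 b).ne'
    field_simp
  have hI := integrableOn_rpow_mul_one_sub_rpow (a := a) (b := -2 - a - b) ha (by linarith)
  constructor
  · rw [← himg, integrableOn_image_iff_integrableOn_abs_deriv_smul measurableSet_Ioo hd hinj]
    exact (integrableOn_congr_fun hcongr measurableSet_Ioo).2 (hI.const_mul _)
  · rw [← himg, integral_image_eq_integral_abs_deriv_smul measurableSet_Ioo hd hinj,
      setIntegral_congr_fun measurableSet_Ioo hcongr, integral_const_mul,
      ← integral_Ioc_eq_integral_Ioo, ← intervalIntegral.integral_of_le zero_le_one,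
      intervalIntegral_rpow_mul_rpow_sub ha (by linarith) one_pos]
    simp
    left
    congr 1
    ring

lemma sin_pi_mul_ne_zero {x : ℝ} (h1 : -1 < x) (h2 : x < 1) (h0 : x ≠ 0) :
    Real.sin (Real.pi * x) ≠ 0 := by
  have hpi := Real.pi_pos
  have hx : Real.pi * x ≠ 0 := mul_ne_zero hpi.ne' h0
  exact fun h => hx ((Real.sin_eq_zero_iff_of_lt_of_lt (by nlinarith) (by nlinarith)).1 h)

/-- The left side is the constant left by two reductions of the exponent `b`. Applying Gamma
reflection at `b` and at `a + b + 1` turns it into the coefficient `regBeta a b`. -/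
lemma mul_beta_eq_beta_mul_sin_div_sin {a b : ℝ} (hb1 : -1 < b) (hb : b < 1)
    (h0 : 0 < a + b + 1) (h2 : a + b + 1 < 2) (h1 : a + b + 1 ≠ 1) :
    b * (b - 1) / ((a + b + 1) * (a + b)) * beta (a + 1) (1 - a - b)
      = beta (a + 1) (b + 1) * Real.sin (Real.pi * b) / Real.sin (Real.pi * (a + b + 1)) := by
  obtain ⟨h, hh⟩ : ∃ h, h = a + b + 1 := ⟨_, rfl⟩
  have hab : a + b = h - 1 := by linarith
  have e1 : a + 1 + (1 - a - b) = (1 - b) + 1 := by ring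
  have e2 : 1 - a - b = (1 - h) + 1 := by linarith
  have e3 : a + 1 + (b + 1) = h + 1 := by linarith
  rw [← hh] at h0 h2 h1 ⊢
  unfold beta
  have h1' : 1 - h ≠ 0 := sub_ne_zero.2 h1.symm
  have h1'' : h - 1 ≠ 0 := sub_ne_zero.2 h1
  have hb' : 1 - b ≠ 0 := by linarith
  rw [e1, e2, e3, hab, Real.Gamma_add_one h1', Real.Gamma_add_one hb', Real.Gamma_add_one h0.ne']
  -- At `b = 0` both sides vanish, while reflection at `b` would divide by `sin (π b) = 0`.
  rcases eq_or_ne b 0 with rfl | hb0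
  · simp
  rw [Real.Gamma_add_one hb0]
  have r1 := Real.Gamma_mul_Gamma_one_sub b
  have r2 := Real.Gamma_mul_Gamma_one_sub h
  have g1 : Real.Gamma (1 - b) ≠ 0 := (Real.Gamma_pos_of_pos (by linarith)).ne'
  have g2 : Real.Gamma h ≠ 0 := (Real.Gamma_pos_of_pos h0).ne'
  have hs : Real.sin (Real.pi * h) ≠ 0 := by
    have := sin_pi_mul_ne_zero (x := h - 1) (by linarith) (by linarith) h1''
    rwa [mul_sub, mul_one, Real.sin_sub_pi, neg_ne_zero] at this
  rw [eq_div_iff hs] at r2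
  have hsb := sin_pi_mul_ne_zero hb1 hb hb0
  rw [eq_div_iff hsb] at r1
  have : Real.Gamma (1 - h) = Real.pi / (Real.Gamma h * Real.sin (Real.pi * h)) := by
    rw [eq_div_iff (mul_ne_zero g2 hs)]; linarith
  rw [this]
  have : Real.Gamma b * Real.sin (Real.pi * b) = Real.pi / Real.Gamma (1 - b) := by
    rw [eq_div_iff g1]; linarith
  have h0' := h0.ne'
  calc _ = b / h * Real.Gamma (a + 1) * (Real.pi / Real.Gamma (1 - b))
        / (Real.Gamma h * Real.sin (Real.pi * h)) := by
        field_simp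
        ring
    _ = _ := by
        rw [← this]
        field_simp

end Beta

lemma integral_sub_sub_add {α : Type*} [MeasurableSpace α] {μ : Measure α} {f g h k : α → ℝ}
    (hf : Integrable f μ) (hg : Integrable g μ) (hh : Integrable h μ) (hk : Integrable k μ) :
    ∫ x, (f x - g x - h x + k x) ∂μ
      = ∫ x, f x ∂μ - ∫ x, g x ∂μ - ∫ x, h x ∂μ + ∫ x, k x ∂μ := by
  rw [integral_add (f := fun x => f x - g x - h x) ((hf.sub hg).sub hh) hk,
    integral_sub (f := fun x => f x - g x) (hf.sub hg) hh, integral_sub hf hg]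

/-! ### One-sided powers -/

section PosPow

lemma posPow_of_pos {y : ℝ} (hy : 0 < y) (a : ℝ) : posPow y a = y ^ a := if_pos hy

lemma posPow_of_nonpos {y : ℝ} (hy : y ≤ 0) (a : ℝ) : posPow y a = 0 := if_neg hy.not_gt

lemma posPow_nonneg (y a : ℝ) : 0 ≤ posPow y a := by
  unfold posPow
  split_ifs with h
  · exact Real.rpow_nonneg h.le a
  · exact le_rfl

lemma posPow_mul_posPow (y a b : ℝ) : posPow y a * posPow y b = posPow y (a + b) := by
  unfold posPow
  split_ifs with h
  · rw [Real.rpow_add h]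
  · simp

lemma measurable_posPow (a : ℝ) : Measurable fun y => posPow y a :=
  Measurable.ite measurableSet_Ioi (by fun_prop) measurable_const

lemma integrableOn_posPow_Iio {a : ℝ} (ha : -1 < a) (c : ℝ) :
    IntegrableOn (fun y => posPow y a) (Iio c) := by
  have h1 : IntegrableOn (fun y => posPow y a) (Iic 0) :=
    (integrableOn_congr_fun (fun y hy => posPow_of_nonpos hy a) measurableSet_Iic).2
      integrableOn_zero
  have h2 : IntegrableOn (fun y => posPow y a) (Ioc 0 |c|) := by
    have := (intervalIntegral.intervalIntegrable_rpow' (a := 0) (b := |c|) ha).1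
    exact (integrableOn_congr_fun (fun y hy => posPow_of_pos hy.1 a) measurableSet_Ioc).2 this
  refine (h1.union h2).mono_set fun y hy => ?_
  rcases le_or_gt y 0 with h | h
  · exact Or.inl h
  · exact Or.inr ⟨h, (le_of_lt hy).trans (le_abs_self c)⟩

lemma memLp_posPow_Iio {a : ℝ} (ha : -(1 / 2) < a) (c : ℝ) :
    MemLp (fun y => posPow y a) 2 (volume.restrict (Iio c)) := by
  rw [memLp_two_iff_integrable_sq (measurable_posPow a).aestronglyMeasurable]
  simp_rw [sq, posPow_mul_posPow]
  exact integrableOn_posPow_Iio (by linarith) c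

lemma memLp_posPow_sub_Ioi {a : ℝ} (ha : -(1 / 2) < a) (t c : ℝ) :
    MemLp (fun x => posPow (t - x) a) 2 (volume.restrict (Ioi c)) := by
  have h : MeasurePreserving (fun x : ℝ => t - x) (volume.restrict (Ioi c))
      (volume.restrict (Iio (t - c))) := by
    have := (Measure.measurePreserving_sub_left (volume : Measure ℝ) t).restrict_preimage
      (measurableSet_Iio (a := t - c))
    simpa using this
  exact (memLp_posPow_Iio ha (t - c)).comp_measurePreserving h

end PosPow

/-! ### Square integrability of the scalar kernel -/

section Increment

/-- The scalar kernel `(t - x)_+ ^ a - (-x)_+ ^ a`. -/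
def incr (a t x : ℝ) : ℝ := posPow (t - x) a - posPow (-x) a

lemma measurable_incr (a t : ℝ) : Measurable (incr a t) :=
  ((measurable_posPow a).comp (measurable_const.sub measurable_id)).sub
    ((measurable_posPow a).comp measurable_neg)

/-- The power lies between `(1 + y)⁻¹` and `1 + y`. After rescaling this gives the decay of order `a
- 1` of the kernel at `-∞`. -/
lemma abs_one_add_rpow_sub_one_le {a y : ℝ} (h1 : -1 ≤ a) (h2 : a ≤ 1) (hy : 0 ≤ y) :
    |(1 + y) ^ a - 1| ≤ y := by
  have hb : 1 ≤ 1 + y := by linarith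
  have hu : (1 + y) ^ a ≤ 1 + y := by
    simpa using Real.rpow_le_rpow_of_exponent_le hb h2
  have hl : (1 + y)⁻¹ ≤ (1 + y) ^ a := by
    simpa [Real.rpow_neg_one] using Real.rpow_le_rpow_of_exponent_le hb h1
  have hl' : 1 - y ≤ (1 + y)⁻¹ := by
    rw [← one_div, le_div_iff₀ (by linarith)]
    nlinarith
  rw [abs_le]
  constructor <;> linarith

lemma abs_rpow_sub_rpow_le {a u v : ℝ} (h1 : -1 ≤ a) (h2 : a ≤ 1) (hu : 0 < u) (huv : u ≤ v) :
    |v ^ a - u ^ a| ≤ (v - u) * u ^ (a - 1) := by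
  have h := abs_one_add_rpow_sub_one_le h1 h2 (y := (v - u) / u) (div_nonneg (by linarith) hu.le)
  have e : 1 + (v - u) / u = v / u := by field_simp; ring
  rw [e, Real.div_rpow (by linarith) hu.le] at h
  have hua := Real.rpow_pos_of_pos hu a
  have e2 : v ^ a - u ^ a = u ^ a * (v ^ a / u ^ a - 1) := by field_simp
  rw [e2, abs_mul, abs_of_pos hua, Real.rpow_sub_one hu.ne']
  calc _ ≤ u ^ a * ((v - u) / u) := by gcongr
    _ = _ := by ring

lemma abs_incr_le_of_le {a t x : ℝ} (h1 : -1 ≤ a) (h2 : a ≤ 1) (hx : x ≤ min 0 t - 1) :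
    |incr a t x| ≤ |t| * (min 0 t - x) ^ (a - 1) := by
  unfold incr
  rcases le_total 0 t with ht | ht
  · rw [min_eq_left ht] at hx ⊢
    rw [posPow_of_pos (by linarith), posPow_of_pos (by linarith), abs_of_nonneg ht]
    have := abs_rpow_sub_rpow_le h1 h2 (u := -x) (v := t - x) (by linarith) (by linarith)
    simpa using this
  · rw [min_eq_right ht] at hx ⊢
    rw [posPow_of_pos (by linarith), posPow_of_pos (by linarith), abs_of_nonpos ht, abs_sub_comm]
    have := abs_rpow_sub_rpow_le h1 h2 (u := t - x) (v := -x) (by linarith) (by linarith)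
    convert this using 2
    ring

/-- A square integrable bound of `incr b t`, for all `b` between `b₀` and `b₁`. -/
def incrBound (b₀ b₁ t x : ℝ) : ℝ :=
  (Ioi (min 0 t - 1)).indicator
      (fun x => posPow (t - x) b₀ + posPow (t - x) b₁ + (posPow (-x) b₀ + posPow (-x) b₁)) x +
    (Iic (min 0 t - 1)).indicator (fun x => |t| * (min 0 t - x) ^ (b₁ - 1)) x

/-- For `y ≤ 1` the smaller exponent dominates, for `y ≥ 1` the larger. A bound uniform in `b` is
needed for dominated convergence when `H_i + H_j = 1`. -/
lemma posPow_le_add {b b₀ b₁ : ℝ} (h₀ : b₀ ≤ b) (h₁ : b ≤ b₁) (y : ℝ) :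
    posPow y b ≤ posPow y b₀ + posPow y b₁ := by
  unfold posPow
  split_ifs with h
  · have p0 := Real.rpow_nonneg h.le b₀
    have p1 := Real.rpow_nonneg h.le b₁
    rcases le_total y 1 with hy | hy
    · linarith [Real.rpow_le_rpow_of_exponent_ge h hy h₀]
    · linarith [Real.rpow_le_rpow_of_exponent_le hy h₁]
  · simp

lemma abs_incr_le_incrBound {b b₀ b₁ : ℝ} (h1 : -1 ≤ b) (h2 : b ≤ 1) (h₀ : b₀ ≤ b) (h₁ : b ≤ b₁)
    (t x : ℝ) : |incr b t x| ≤ incrBound b₀ b₁ t x := by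
  unfold incrBound
  rcases le_or_gt x (min 0 t - 1) with hx | hx
  · rw [indicator_of_notMem (by simpa using hx), indicator_of_mem (by simpa using hx), zero_add]
    refine (abs_incr_le_of_le h1 h2 hx).trans ?_
    exact mul_le_mul_of_nonneg_left
      (Real.rpow_le_rpow_of_exponent_le (by linarith) (by linarith)) (abs_nonneg t)
  · rw [indicator_of_mem (by simpa using hx), indicator_of_notMem (by simpa using hx), add_zero]
    have p1 := posPow_le_add h₀ h₁ (t - x)
    have p2 := posPow_le_add h₀ h₁ (-x)
    have n1 := posPow_nonneg (t - x) b
    have n2 := posPow_nonneg (-x) b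
    unfold incr
    rw [abs_le]
    constructor <;> linarith

/-- The singularities are square integrable because `2 b₀ > -1`, and the tail because `2 (b₁ - 1) <
-1`. -/
lemma memLp_incrBound {b₀ b₁ : ℝ} (h₀ : -(1 / 2) < b₀) (h₀₁ : b₀ ≤ b₁) (h₁ : b₁ < 1 / 2) (t : ℝ) :
    MemLp (incrBound b₀ b₁ t) 2 volume := by
  have hb1 : -(1 / 2) < b₁ := by linarith
  refine MemLp.add ?_ ?_
  · rw [memLp_indicator_iff_restrict measurableSet_Ioi]
    have hz : ∀ a : ℝ, -(1 / 2) < a →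
        MemLp (fun x => posPow (-x) a) 2 (volume.restrict (Ioi (min 0 t - 1))) := fun a ha => by
      simpa using memLp_posPow_sub_Ioi ha 0 (min 0 t - 1)
    exact ((memLp_posPow_sub_Ioi h₀ t _).add (memLp_posPow_sub_Ioi hb1 t _)).add
      ((hz b₀ h₀).add (hz b₁ hb1))
  · rw [memLp_indicator_iff_restrict measurableSet_Iic]
    refine MemLp.const_mul ?_ |t|
    rw [memLp_two_iff_integrable_sq
      (Measurable.aestronglyMeasurable (by fun_prop))]
    have hI : IntegrableOn (fun y : ℝ => (y ^ (b₁ - 1)) ^ 2) (Ici 1) := by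
      have := (integrableOn_Ici_iff_integrableOn_Ioi).2
        (integrableOn_Ioi_rpow_of_lt (a := 2 * (b₁ - 1)) (by linarith) one_pos)
      refine (integrableOn_congr_fun (fun y hy => ?_) measurableSet_Ici).1 this
      have hy : (1 : ℝ) ≤ y := hy
      rw [mul_comm, Real.rpow_mul (by linarith), Real.rpow_two]
    have hmp : MeasurePreserving (fun x : ℝ => min 0 t - x)
        (volume.restrict (Iic (min 0 t - 1))) (volume.restrict (Ici 1)) := by
      have := (Measure.measurePreserving_sub_left (volume : Measure ℝ) (min 0 t)).restrict_preimage
        (measurableSet_Ici (a := (1 : ℝ)))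
      simpa using this
    exact hmp.integrable_comp_of_integrable hI

lemma memLp_incr {a : ℝ} (h0 : -(1 / 2) < a) (h1 : a < 1 / 2) (t : ℝ) :
    MemLp (incr a t) 2 volume :=
  (memLp_incrBound h0 le_rfl h1 t).mono (measurable_incr a t).aestronglyMeasurable
    (Eventually.of_forall fun x => by
      rw [Real.norm_eq_abs, Real.norm_eq_abs]
      exact (abs_incr_le_incrBound (by linarith) (by linarith) le_rfl le_rfl t x).trans
        (le_abs_self _))

end Increment

/-! ### Truncated integrals and the covariance when `a + b ≠ 0` -/

section Truncated

lemma intervalIntegrable_rpow_mul_add_rpow {a δ : ℝ} (ha : -1 < a) (hδ : 0 < δ) (b : ℝ) {L : ℝ}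
    (hL : 0 ≤ L) : IntervalIntegrable (fun u : ℝ => u ^ a * (u + δ) ^ b) volume 0 L := by
  refine (intervalIntegral.intervalIntegrable_rpow' ha).mul_continuousOn ?_
  rw [uIcc_of_le hL]
  exact ContinuousOn.rpow_const (by fun_prop) fun u hu => Or.inl (by linarith [hu.1])

/-- Differentiate `u ^ (a + 1) * (u + δ) ^ b` and write one factor `u` as `(u + δ) - δ`. The
boundary term at 0 vanishes since `a + 1 > 0`. -/
lemma integral_rpow_mul_add_rpow_recurrence {a δ : ℝ} (ha : -1 < a) (hδ : 0 < δ) (b : ℝ) {L : ℝ}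
    (hL : 0 ≤ L) :
    (a + b + 1) * ∫ u in 0..L, u ^ a * (u + δ) ^ b
      = L ^ (a + 1) * (L + δ) ^ b + b * δ * ∫ u in 0..L, u ^ a * (u + δ) ^ (b - 1) := by
  have I1 := intervalIntegrable_rpow_mul_add_rpow ha hδ b hL
  have I2 := intervalIntegrable_rpow_mul_add_rpow ha hδ (b - 1) hL
  have h := intervalIntegral.integral_eq_sub_of_hasDerivAt_of_le hL
    (f := fun u => u ^ (a + 1) * (u + δ) ^ b)
    (f' := fun u => (a + b + 1) * (u ^ a * (u + δ) ^ b) - b * δ * (u ^ a * (u + δ) ^ (b - 1)))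
    ?_ ?_ ((I1.const_mul _).sub (I2.const_mul _))
  · rw [intervalIntegral.integral_sub (I1.const_mul _) (I2.const_mul _),
      intervalIntegral.integral_const_mul, intervalIntegral.integral_const_mul,
      Real.zero_rpow (by linarith)] at h
    linarith
  · refine ContinuousOn.mul ?_ ?_
    · exact ContinuousOn.rpow_const (by fun_prop) fun u hu => Or.inr (by linarith)
    · exact ContinuousOn.rpow_const (by fun_prop) fun u hu => Or.inl (by linarith [hu.1])
  · intro u hu
    have hu0 : 0 < u := hu.1
    have hud : 0 < u + δ := by linarith
    have d1 := (hasDerivAt_id u).rpow_const (p := a + 1) (Or.inl hu0.ne')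
    have d2 := ((hasDerivAt_id u).add_const δ).rpow_const (p := b) (Or.inl hud.ne')
    refine (d1.mul d2).congr_deriv ?_
    simp only [id]
    have e1 : u ^ (a + 1) = u ^ a * u := Real.rpow_add_one hu0.ne' a
    have e2 : (u + δ) ^ b = (u + δ) ^ (b - 1) * (u + δ) := by
      rw [← Real.rpow_add_one hud.ne']; simp
    rw [e1, e2]
    simp only [add_sub_cancel_right]
    ring

/-- Two reductions bring the exponent down to `b - 2`, where the integral converges as `L → ∞` as
soon as `a + b < 1`. -/
lemma integral_rpow_mul_add_rpow_expand {a δ : ℝ} (ha : -1 < a) (hδ : 0 < δ) (b : ℝ) {L : ℝ}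
    (hL : 0 ≤ L) :
    (a + b + 1) * (a + b) * ∫ u in 0..L, u ^ a * (u + δ) ^ b
      = (a + b) * (L ^ (a + 1) * (L + δ) ^ b) + b * δ * (L ^ (a + 1) * (L + δ) ^ (b - 1))
        + b * (b - 1) * δ ^ 2 * ∫ u in 0..L, u ^ a * (u + δ) ^ (b - 2) := by
  have h1 := integral_rpow_mul_add_rpow_recurrence ha hδ b hL
  have h2 := integral_rpow_mul_add_rpow_recurrence ha hδ (b - 1) hL
  have e : b - 1 - 1 = b - 2 := by ring
  rw [e] at h2
  linear_combination (a + b) * h1 + b * δ * h2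

/-- The integral of `(s - x)_+ ^ a (t - x)_+ ^ b` over `x > -N`. -/
def truncProd (a b s t N : ℝ) : ℝ := ∫ x in Ioi (-N), posPow (s - x) a * posPow (t - x) b

lemma truncProd_swap (a b s t N : ℝ) : truncProd a b s t N = truncProd b a t s N := by
  unfold truncProd
  simp_rw [mul_comm]

lemma truncProd_eq_of_le {a b s t N : ℝ} (hst : s ≤ t) (hN : -s ≤ N) :
    truncProd a b s t N = ∫ u in 0..(N + s), u ^ a * (u + (t - s)) ^ b := by
  unfold truncProd
  rw [intervalIntegral.integral_of_le (by linarith), integral_Ioc_eq_integral_Ioo,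
    ← integral_indicator measurableSet_Ioo, ← integral_indicator measurableSet_Ioi,
    ← integral_sub_left_eq_self _ volume s]
  congr 1 with x
  by_cases h1 : s - x ∈ Ioi (-N)
  · rw [indicator_of_mem h1]
    have h1' : -N < s - x := h1
    by_cases h2 : 0 < x
    · rw [indicator_of_mem (show x ∈ Ioo 0 (N + s) from ⟨h2, by linarith⟩), posPow_of_pos (by linarith),
        posPow_of_pos (by linarith)]
      ring_nf
    · rw [indicator_of_notMem (fun h => h2 h.1), posPow_of_nonpos (by linarith), zero_mul]
  · rw [indicator_of_notMem h1, indicator_of_notMem]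
    intro h
    have h1' : ¬ (-N < s - x) := h1
    have := h.2
    linarith

/-- The coefficient of the regularized integral of `u_+ ^ a (u + 1)_+ ^ b`. -/
def regBeta (a b : ℝ) : ℝ :=
  beta (a + 1) (b + 1) * Real.sin (Real.pi * b) / Real.sin (Real.pi * (a + b + 1))

/-- The regularized value of the integral of `(s - x)_+ ^ a (t - x)_+ ^ b`, in terms of
`δ = t - s`. -/
def regProd (a b δ : ℝ) : ℝ :=
  regBeta a b * posPow δ (a + b + 1) + regBeta b a * posPow (-δ) (a + b + 1)

/-- The boundary terms of the double reduction carry all the divergence: their `N ^ (a + b)` parts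
add up to the coefficient `(a s + b t) / (a + b)`. The remaining integral tends to a Beta value. -/
lemma tendsto_truncProd_of_lt {a b s t : ℝ} (ha : -1 < a) (hb : -1 < b) (hb' : b < 1)
    (h0 : 0 < a + b + 1) (h1 : a + b + 1 ≠ 1) (h2 : a + b + 1 < 2) (hst : s < t) :
    Tendsto (fun N => truncProd a b s t N - N ^ (a + b + 1) / (a + b + 1)
      - (a * s + b * t) / (a + b) * N ^ (a + b)) atTop
      (𝓝 (regBeta a b * (t - s) ^ (a + b + 1))) := by
  have hδ : 0 < t - s := sub_pos.2 hst
  have hab : a + b ≠ 0 := fun h => h1 (by linarith)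
  obtain ⟨hI, hV⟩ := integral_Ioi_rpow_mul_add_rpow (a := a) (b := b - 2) ha (by linarith) hδ
  have l1 := intervalIntegral_tendsto_integral_Ioi 0 hI
    (tendsto_atTop_add_const_right atTop s tendsto_id)
  have l2 := tendsto_shifted_rpow_mul_sub_two (α := a + 1) (β := b) (by linarith) s t
  have l3 := tendsto_shifted_rpow_mul_sub (α := a + 1) (β := b - 1) (by linarith) s t
  have hlim := ((l2.const_mul (1 / (a + b + 1))).add
    (l3.const_mul (b * (t - s) / ((a + b + 1) * (a + b))))).add
    (l1.const_mul (b * (b - 1) * (t - s) ^ 2 / ((a + b + 1) * (a + b))))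
  have hval : 1 / (a + b + 1) * 0 + b * (t - s) / ((a + b + 1) * (a + b)) * 0 +
      b * (b - 1) * (t - s) ^ 2 / ((a + b + 1) * (a + b)) *
        ∫ u in Ioi 0, u ^ a * (u + (t - s)) ^ (b - 2) = regBeta a b * (t - s) ^ (a + b + 1) := by
    rw [hV, regBeta, ← mul_beta_eq_beta_mul_sin_div_sin hb hb' h0 h2 h1]
    have e1 : -1 - a - (b - 2) = 1 - a - b := by ring
    have e2 : (t - s) ^ (a + b + 1) = (t - s) ^ (a + (b - 2) + 1) * (t - s) ^ 2 := by
      rw [← Real.rpow_two, ← Real.rpow_add hδ]; congr 1; ring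
    rw [e1, e2]
    ring
  rw [hval] at hlim
  refine hlim.congr' ?_
  filter_upwards [eventually_ge_atTop (-s)] with N hN
  rw [truncProd_eq_of_le hst.le hN]
  have hex := integral_rpow_mul_add_rpow_expand ha hδ b (L := N + s) (by linarith)
  have e1 : N + s + (t - s) = N + t := by ring
  rw [e1] at hex
  have hJ : ∫ u in 0..(N + s), u ^ a * (u + (t - s)) ^ b
      = ((a + b) * ((N + s) ^ (a + 1) * (N + t) ^ b)
        + b * (t - s) * ((N + s) ^ (a + 1) * (N + t) ^ (b - 1))
        + b * (b - 1) * (t - s) ^ 2 * ∫ u in 0..(N + s), u ^ a * (u + (t - s)) ^ (b - 2))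
        / ((a + b + 1) * (a + b)) := by
    rw [eq_div_iff (mul_ne_zero h0.ne' hab), ← hex]; ring
  rw [hJ]
  have e2 : a + 1 + b = a + b + 1 := by ring
  have e3 : a + b + 1 - 1 = a + b := by ring
  have e4 : a + 1 + (b - 1) = a + b := by ring
  simp only [id, e2, e3, e4]
  have h0' := h0.ne'
  field_simp
  ring

lemma tendsto_truncProd {a b : ℝ} (ha : -1 < a) (ha' : a < 1) (hb : -1 < b) (hb' : b < 1)
    (h0 : 0 < a + b + 1) (h1 : a + b + 1 ≠ 1) (h2 : a + b + 1 < 2) (s t : ℝ) :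
    Tendsto (fun N => truncProd a b s t N - N ^ (a + b + 1) / (a + b + 1)
      - (a * s + b * t) / (a + b) * N ^ (a + b)) atTop (𝓝 (regProd a b (t - s))) := by
  have hab : a + b ≠ 0 := fun h => h1 (by linarith)
  unfold regProd
  rcases lt_trichotomy s t with h | h | h
  · rw [posPow_of_pos (by linarith), posPow_of_nonpos (by linarith), mul_zero, add_zero]
    exact tendsto_truncProd_of_lt ha hb hb' h0 h1 h2 h
  · subst h
    -- On the diagonal the integrand is the single power `u ^ (a + b)`; `β = 0` leaves one factor in
    -- the expansion.
    have l := (tendsto_shifted_rpow_mul_sub_two (α := a + b + 1) (β := 0) (by linarith) s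
      0).const_mul (1 / (a + b + 1))
    simp only [sub_self, neg_zero, posPow_of_nonpos le_rfl, mul_zero, add_zero] at l ⊢
    refine l.congr' ?_
    filter_upwards [eventually_ge_atTop (-s)] with N hN
    rw [truncProd_eq_of_le le_rfl hN]
    have : ∫ u in 0..(N + s), u ^ a * (u + (s - s)) ^ b = ∫ u in 0..(N + s), u ^ (a + b) := by
      refine intervalIntegral.integral_congr_ae (Eventually.of_forall fun u hu => ?_)
      rw [uIoc_of_le (by linarith)] at hu
      rw [sub_self, add_zero, Real.rpow_add hu.1]
    rw [this, integral_rpow (Or.inl (by linarith)), Real.zero_rpow h0.ne']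
    have e3 : a + b + 1 - 1 = a + b := by ring
    have h0' := h0.ne'
    rw [e3]
    simp
    field_simp
  · rw [posPow_of_nonpos (by linarith), posPow_of_pos (by linarith), mul_zero, zero_add]
    have e : b + a = a + b := add_comm b a
    have := tendsto_truncProd_of_lt (a := b) (b := a) hb ha ha' (by linarith)
      (by rwa [e]) (by linarith) h
    rw [e] at this
    simp_rw [truncProd_swap b a t s] at this
    convert this using 4
    · ring
    · ring

lemma truncProd_integrableOn {a b : ℝ} (ha : -(1 / 2) < a) (hb : -(1 / 2) < b) (s t N : ℝ) :
    IntegrableOn (fun x => posPow (s - x) a * posPow (t - x) b) (Ioi (-N)) :=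
  integrable_mul_of_memLp_two (memLp_posPow_sub_Ioi ha s _) (memLp_posPow_sub_Ioi hb t _)

/-- The divergent part of `truncProd` is a function of `s` plus a function of `t`, so it cancels in
the combination at `(s, t)`, `(s, 0)`, `(0, t)`, `(0, 0)`. -/
lemma integral_incr_mul_incr {a b : ℝ} (ha : -(1 / 2) < a) (ha' : a < 1 / 2) (hb : -(1 / 2) < b)
    (hb' : b < 1 / 2) (hab : a + b ≠ 0) (s t : ℝ) :
    ∫ x, incr a s x * incr b t x = regProd a b (t - s) - regProd a b t - regProd a b (-s) := by
  have hI := integrable_mul_of_memLp_two (memLp_incr ha ha' s) (memLp_incr hb hb' t)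
  have l1 := AECover.integral_tendsto_of_countably_generated
    (aecover_Ioi (μ := volume) tendsto_neg_atTop_atBot) hI
  have T := fun s t => tendsto_truncProd (a := a) (b := b) (by linarith) (by linarith)
    (by linarith) (by linarith) (by linarith) (fun h => hab (by linarith)) (by linarith) s t
  have l2 := (((T s t).sub (T s 0)).sub (T 0 t)).add (T 0 0)
  have hz : regProd a b 0 = 0 := by simp [regProd, posPow_of_nonpos]
  simp only [sub_zero, zero_sub, hz, add_zero] at l2
  have hval : regProd a b (t - s) - regProd a b t - regProd a b (-s)
      = regProd a b (t - s) - regProd a b (-s) - regProd a b t := by ring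
  rw [hval]
  refine tendsto_nhds_unique l1 (l2.congr fun N => ?_)
  have J := fun s t => truncProd_integrableOn ha hb s t N
  have hexp : ∫ x in Ioi (-N), incr a s x * incr b t x
      = truncProd a b s t N - truncProd a b s 0 N - truncProd a b 0 t N + truncProd a b 0 0 N := by
    have e : (fun x => incr a s x * incr b t x) = fun x =>
        posPow (s - x) a * posPow (t - x) b - posPow (s - x) a * posPow (0 - x) b
          - posPow (0 - x) a * posPow (t - x) b + posPow (0 - x) a * posPow (0 - x) b := by
      funext x
      simp only [incr, zero_sub]
      ring
    rw [e, integral_sub_sub_add (J s t) (J s 0) (J 0 t) (J 0 0)]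
    rfl
  rw [hexp]
  ring

end Truncated

/-! ### The critical case `a + b = 0` as a limit -/

section Critical

lemma tendsto_div_of_hasDerivAt {f g : ℝ → ℝ} {f' g' x : ℝ} (hf : HasDerivAt f f' x)
    (hg : HasDerivAt g g' x) (hf0 : f x = 0) (hg0 : g x = 0) (hg' : g' ≠ 0) :
    Tendsto (fun y => f y / g y) (𝓝[≠] x) (𝓝 (f' / g')) := by
  refine (hf.tendsto_slope.div hg.tendsto_slope hg').congr' ?_
  filter_upwards [self_mem_nhdsWithin] with y hy
  have : y - x ≠ 0 := sub_ne_zero.2 hy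
  simp only [Pi.div_apply, slope_def_field, hf0, hg0, sub_zero]
  field_simp

lemma hasDerivAt_signed_posPow (a δ : ℝ) :
    HasDerivAt (fun b => posPow δ (a + b + 1) - posPow (-δ) (a + b + 1)) (δ * Real.log |δ|)
      (-a) := by
  have key : ∀ y : ℝ, 0 < y → HasDerivAt (fun b => y ^ (a + b + 1)) (y * Real.log y) (-a) := by
    intro y hy
    have h := (((hasDerivAt_id (-a)).const_add a).add_const 1).const_rpow hy
    refine h.congr_deriv ?_
    simp [mul_comm]
  rcases lt_trichotomy δ 0 with h | h | h
  · simp_rw [posPow_of_nonpos h.le, posPow_of_pos (neg_pos.2 h), zero_sub]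
    refine (key (-δ) (neg_pos.2 h)).neg.congr_deriv ?_
    rw [abs_of_neg h]
    ring
  · subst h
    simpa [posPow_of_nonpos] using hasDerivAt_const (-a) (0 : ℝ)
  · simp_rw [posPow_of_pos h, posPow_of_nonpos (neg_nonpos.2 h.le), sub_zero, abs_of_pos h]
    exact key δ h

lemma signed_posPow_one (δ : ℝ) : posPow δ 1 - posPow (-δ) 1 = δ := by
  rcases le_or_gt δ 0 with h | h
  · rcases h.eq_or_lt with rfl | h
    · simp [posPow_of_nonpos]
    · simp [posPow_of_nonpos h.le, posPow_of_pos (neg_pos.2 h)]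
  · simp [posPow_of_pos h, posPow_of_nonpos (neg_nonpos.2 h.le)]

lemma posPow_add_posPow_neg {h : ℝ} (hh : h ≠ 0) (δ : ℝ) :
    posPow δ h + posPow (-δ) h = |δ| ^ h := by
  rcases lt_trichotomy δ 0 with hd | hd | hd
  · rw [posPow_of_nonpos hd.le, posPow_of_pos (neg_pos.2 hd), abs_of_neg hd, zero_add]
  · simp [hd, posPow_of_nonpos, Real.zero_rpow hh]
  · rw [posPow_of_pos hd, posPow_of_nonpos (neg_nonpos.2 hd.le), abs_of_pos hd, add_zero]

/-- Even and odd parts in `δ`. At `b = -a` the even part has a 0/0 coefficient with a finite limit.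
The odd part has a pole, but its power becomes `δ` itself, which the second difference kills; the
derivative in `b` survives as `δ log |δ|`. -/
lemma regProd_eq_add_signed (a b δ : ℝ) (h : a + b + 1 ≠ 0) :
    regProd a b δ = beta (a + 1) (b + 1) *
      ((Real.sin (Real.pi * b) + Real.sin (Real.pi * a)) / Real.sin (Real.pi * (a + b + 1))
          * (|δ| ^ (a + b + 1) / 2) +
        (Real.sin (Real.pi * b) - Real.sin (Real.pi * a)) / 2 *
          ((posPow δ (a + b + 1) - posPow (-δ) (a + b + 1)) / Real.sin (Real.pi * (a + b + 1)))) := by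
  rw [← posPow_add_posPow_neg h, regProd, regBeta, regBeta, beta_comm (b + 1), add_comm b a]
  ring

lemma beta_one_add_one_sub {a : ℝ} (h : a ≠ 0) :
    beta (a + 1) (-a + 1) = Real.pi * a / Real.sin (Real.pi * a) := by
  have e : a + 1 + (-a + 1) = 1 + 1 := by ring
  have e2 : -a + 1 = 1 - a := by ring
  unfold beta
  rw [e, Real.Gamma_add_one h, Real.Gamma_add_one one_ne_zero, Real.Gamma_one, e2, mul_assoc,
    Real.Gamma_mul_Gamma_one_sub]
  ring

lemma continuousAt_beta_right {x y : ℝ} (hx : 0 < x) (hy : 0 < y) :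
    ContinuousAt (fun z => beta x z) y := by
  have hG : ∀ z : ℝ, 0 < z → ContinuousAt Real.Gamma z := fun z hz =>
    (Real.differentiableAt_Gamma fun m => by
      have : (0 : ℝ) ≤ m := m.cast_nonneg
      linarith).continuousAt
  unfold beta
  refine ContinuousAt.div (continuousAt_const.mul (hG y hy)) ?_
    (Real.Gamma_pos_of_pos (by linarith)).ne'
  exact ContinuousAt.comp (f := fun z => x + z) (hG (x + y) (by linarith)) (by fun_prop)

lemma tendsto_integral_incr_mul_incr {a b : ℝ} (ha : -(1 / 2) < a) (ha' : a < 1 / 2)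
    (hb : -(1 / 2) < b) (hb' : b < 1 / 2) (s t : ℝ) :
    Tendsto (fun β => ∫ x, incr a s x * incr β t x) (𝓝 b)
      (𝓝 (∫ x, incr a s x * incr b t x)) := by
  obtain ⟨b₀, h0, h0'⟩ := exists_between hb
  obtain ⟨b₁, h1, h1'⟩ := exists_between hb'
  refine tendsto_integral_filter_of_dominated_convergence
    (fun x => |incr a s x| * incrBound b₀ b₁ t x) ?_ ?_ ?_ ?_
  · exact Eventually.of_forall fun β =>
      ((measurable_incr a s).mul (measurable_incr β t)).aestronglyMeasurable
  · filter_upwards [Icc_mem_nhds h0' h1] with β hβ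
    refine Eventually.of_forall fun x => ?_
    rw [norm_mul, Real.norm_eq_abs, Real.norm_eq_abs]
    exact mul_le_mul_of_nonneg_left (abs_incr_le_incrBound (by linarith [hβ.1])
      (by linarith [hβ.2]) hβ.1 hβ.2 t x) (abs_nonneg _)
  · exact integrable_mul_of_memLp_two (memLp_incr ha ha' s).abs
      (memLp_incrBound h0 (h0'.trans h1).le h1' t)
  · refine Eventually.of_forall fun x => Tendsto.const_mul _ ?_
    have hc : ∀ y : ℝ, Tendsto (fun β => posPow y β) (𝓝 b) (𝓝 (posPow y b)) := by
      intro y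
      unfold posPow
      split_ifs with hy
      · exact (Real.continuousAt_const_rpow hy.ne').tendsto
      · exact tendsto_const_nhds
    exact (hc _).sub (hc _)

lemma integral_incr_mul_incr_neg_exponent {a : ℝ} (ha : -(1 / 2) < a) (ha' : a < 1 / 2)
    (s t : ℝ) :
    ∫ x, incr a s x * incr (-a) t x
      = beta (a + 1) (-a + 1) * Real.cos (Real.pi * a) / 2 * (|s| + |t| - |t - s|)
        - a * (t * Real.log |t| - s * Real.log |s| - (t - s) * Real.log |t - s|) := by
  have l1 := (tendsto_integral_incr_mul_incr ha ha' (b := -a) (by linarith) (by linarith)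
    s t).mono_left (nhdsWithin_le_nhds (s := {-a}ᶜ))
  refine tendsto_nhds_unique l1 ?_
  have hgD : HasDerivAt (fun b => Real.sin (Real.pi * (a + b + 1))) (-Real.pi) (-a) := by
    have := ((((hasDerivAt_id (-a)).const_add a).add_const 1).const_mul Real.pi).sin
    refine this.congr_deriv ?_
    simp
  have hg0 : Real.sin (Real.pi * (a + -a + 1)) = 0 := by simp
  have hpi : -Real.pi ≠ 0 := neg_ne_zero.2 Real.pi_pos.ne'
  have hsum : Tendsto (fun b => (Real.sin (Real.pi * b) + Real.sin (Real.pi * a))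
      / Real.sin (Real.pi * (a + b + 1))) (𝓝[≠] (-a)) (𝓝 (-Real.cos (Real.pi * a))) := by
    have hfD : HasDerivAt (fun b => Real.sin (Real.pi * b) + Real.sin (Real.pi * a))
        (Real.cos (Real.pi * a) * Real.pi) (-a) := by
      have := (((hasDerivAt_id (-a)).const_mul Real.pi).sin).add_const (Real.sin (Real.pi * a))
      refine this.congr_deriv ?_
      simp
    have := tendsto_div_of_hasDerivAt hfD hgD (by simp) hg0 hpi
    convert this using 2
    field_simp
  -- The numerator vanishes at `b = -a` because `(t - s) - t + s = 0`.
  have hdiff : Tendsto (fun b =>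
      (posPow (t - s) (a + b + 1) - posPow (-(t - s)) (a + b + 1))
          / Real.sin (Real.pi * (a + b + 1))
        - (posPow t (a + b + 1) - posPow (-t) (a + b + 1)) / Real.sin (Real.pi * (a + b + 1))
        - (posPow (-s) (a + b + 1) - posPow (-(-s)) (a + b + 1))
          / Real.sin (Real.pi * (a + b + 1)))
      (𝓝[≠] (-a)) (𝓝 ((t * Real.log |t| - s * Real.log |s| - (t - s) * Real.log |t - s|)
        / Real.pi)) := by
    have hfD := ((hasDerivAt_signed_posPow a (t - s)).sub (hasDerivAt_signed_posPow a t)).sub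
      (hasDerivAt_signed_posPow a (-s))
    have := tendsto_div_of_hasDerivAt hfD hgD ?_ hg0 hpi
    · convert this using 2
      · simp only [Pi.sub_apply]
        ring
      · rw [abs_neg]
        field_simp
        ring
    · have e : a + -a + 1 = 1 := by ring
      simp only [Pi.sub_apply, e, signed_posPow_one]
      ring
  have hexp : ContinuousAt (fun b : ℝ => a + b + 1) (-a) := by fun_prop
  have e1 : a + -a + 1 = 1 := by ring
  have hpow : ∀ δ : ℝ, Tendsto (fun b => |δ| ^ (a + b + 1)) (𝓝[≠] (-a)) (𝓝 |δ|) := by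
    intro δ
    have h := (ContinuousAt.rpow (continuousAt_const (y := |δ|)) hexp
      (Or.inr (by rw [e1]; exact one_pos))).tendsto
    rw [e1, Real.rpow_one] at h
    exact h.mono_left nhdsWithin_le_nhds
  have hbeta : Tendsto (fun b => beta (a + 1) (b + 1)) (𝓝[≠] (-a))
      (𝓝 (beta (a + 1) (-a + 1))) := by
    have h : ContinuousAt (fun b => beta (a + 1) (b + 1)) (-a) :=
      ContinuousAt.comp (f := fun b => b + 1) (continuousAt_beta_right (by linarith)
        (by linarith)) (by fun_prop)
    exact h.tendsto.mono_left nhdsWithin_le_nhds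
  have hsin : Tendsto (fun b => (Real.sin (Real.pi * b) - Real.sin (Real.pi * a)) / 2) (𝓝[≠] (-a))
      (𝓝 (-Real.sin (Real.pi * a))) := by
    have h : Continuous (fun b => (Real.sin (Real.pi * b) - Real.sin (Real.pi * a)) / 2) := by
      fun_prop
    have h2 := (h.tendsto (-a)).mono_left (nhdsWithin_le_nhds (s := {-a}ᶜ))
    convert h2 using 2
    simp only [mul_neg, Real.sin_neg]
    ring
  have hlim := hbeta.mul ((hsum.mul ((((hpow (t - s)).sub (hpow t)).sub (hpow (-s))).div_const
    2)).add (hsin.mul hdiff))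
  have hval : beta (a + 1) (-a + 1) * (-Real.cos (Real.pi * a) * ((|t - s| - |t| - |-s|) / 2) +
      -Real.sin (Real.pi * a) * ((t * Real.log |t| - s * Real.log |s|
        - (t - s) * Real.log |t - s|) / Real.pi))
      = beta (a + 1) (-a + 1) * Real.cos (Real.pi * a) / 2 * (|s| + |t| - |t - s|)
        - a * (t * Real.log |t| - s * Real.log |s| - (t - s) * Real.log |t - s|) := by
    -- By reflection the Beta factor cancels the sine, which is why the logarithmic coefficient
    -- contains no Beta function.
    have hB : beta (a + 1) (-a + 1) * Real.sin (Real.pi * a) / Real.pi = a := by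
      rcases eq_or_ne a 0 with rfl | h
      · simp
      · have := sin_pi_mul_ne_zero (x := a) (by linarith) (by linarith) h
        rw [beta_one_add_one_sub h]
        field_simp
    rw [abs_neg]
    linear_combination (-(t * Real.log |t| - s * Real.log |s|
        - (t - s) * Real.log |t - s|)) * hB
  rw [hval] at hlim
  refine hlim.congr' ?_
  have hnear : Ioo (-(1 / 2)) (1 / 2) ∈ 𝓝[≠] (-a) :=
    mem_nhdsWithin_of_mem_nhds (Ioo_mem_nhds (by linarith) (by linarith))
  filter_upwards [hnear, self_mem_nhdsWithin] with b hb hne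
  have hab : a + b ≠ 0 := fun h => hne (by simp only [mem_singleton_iff]; linarith)
  have hne : a + b + 1 ≠ 0 := by linarith [hb.1]
  rw [integral_incr_mul_incr ha ha' hb.1 hb.2 hab, regProd_eq_add_signed a b _ hne,
    regProd_eq_add_signed a b _ hne, regProd_eq_add_signed a b _ hne]
  ring

end Critical

/-! ### Mixed products of a kernel and a reflected kernel -/

section Cross

lemma integral_posPow_mul_posPow_cross {a b : ℝ} (ha : -1 < a) (hb : -1 < b) (s t : ℝ) :
    ∫ x, posPow (s - x) a * posPow (x - t) b
      = beta (a + 1) (b + 1) * posPow (s - t) (a + b + 1) := by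
  rcases le_or_gt s t with h | h
  · rw [posPow_of_nonpos (by linarith), mul_zero]
    refine (integral_congr_ae (Eventually.of_forall fun x => ?_)).trans (integral_zero _ _)
    rcases le_or_gt s x with hx | hx
    · simp [posPow_of_nonpos (sub_nonpos.2 hx)]
    · simp [posPow_of_nonpos (y := x - t) (by linarith)]
  · rw [posPow_of_pos (sub_pos.2 h), mul_comm,
      ← intervalIntegral_rpow_mul_rpow_sub ha hb (sub_pos.2 h),
      intervalIntegral.integral_of_le (by linarith), integral_Ioc_eq_integral_Ioo,
      ← integral_indicator measurableSet_Ioo, ← integral_sub_left_eq_self _ volume s]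
    congr 1 with x
    by_cases h1 : 0 < x
    · by_cases h2 : x < s - t
      · rw [indicator_of_mem (show x ∈ Ioo 0 (s - t) from ⟨h1, h2⟩), posPow_of_pos (by linarith),
          posPow_of_pos (by linarith)]
        ring_nf
      · rw [indicator_of_notMem (fun h => h2 h.2), posPow_of_nonpos (y := s - x - t) (by linarith),
          mul_zero]
    · rw [indicator_of_notMem (fun h => h1 h.1), posPow_of_nonpos (by linarith), zero_mul]

lemma integrable_posPow_mul_posPow_cross {a b : ℝ} (ha : -1 < a) (hb : -1 < b) (s t : ℝ) :
    Integrable (fun x => posPow (s - x) a * posPow (x - t) b) := by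
  rcases le_or_gt s t with h | h
  · refine (integrable_zero ℝ ℝ volume).congr (Eventually.of_forall fun x => ?_)
    rcases le_or_gt s x with hx | hx
    · simp [posPow_of_nonpos (sub_nonpos.2 hx)]
    · simp [posPow_of_nonpos (y := x - t) (by linarith)]
  -- A nonintegrable function has integral 0 by convention, so the positive Beta value already
  -- proves integrability.
  · refine Integrable.of_integral_ne_zero ?_
    rw [integral_posPow_mul_posPow_cross ha hb, posPow_of_pos (sub_pos.2 h)]
    exact (mul_pos (beta_pos (by linarith) (by linarith))
      (Real.rpow_pos_of_pos (sub_pos.2 h) _)).ne'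

lemma integral_incr_mul_incr_reflect {a b : ℝ} (ha : -1 < a) (hb : -1 < b) (s t : ℝ) :
    ∫ x, incr a s x * incr b (-t) (-x)
      = beta (a + 1) (b + 1) *
        (posPow (s - t) (a + b + 1) - posPow s (a + b + 1) - posPow (-t) (a + b + 1)) := by
  have J := integrable_posPow_mul_posPow_cross ha hb
  have e : (fun x => incr a s x * incr b (-t) (-x)) = fun x =>
      posPow (s - x) a * posPow (x - t) b - posPow (s - x) a * posPow (x - 0) b
        - posPow (0 - x) a * posPow (x - t) b + posPow (0 - x) a * posPow (x - 0) b := by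
    funext x
    have e1 : -t - -x = x - t := by ring
    simp only [incr, zero_sub, sub_zero, neg_neg, e1]
    ring
  rw [e, integral_sub_sub_add (J s t) (J s 0) (J 0 t) (J 0 0)]
  simp_rw [integral_posPow_mul_posPow_cross ha hb]
  simp only [sub_zero, zero_sub, posPow_of_nonpos le_rfl]
  ring

lemma integral_incr_reflect_mul_incr_reflect (a b s t : ℝ) :
    ∫ x, incr a (-s) (-x) * incr b (-t) (-x) = ∫ x, incr a (-s) x * incr b (-t) x :=
  integral_neg_eq_self (fun x => incr a (-s) x * incr b (-t) x) volume

lemma memLp_incr_reflect {a : ℝ} (h0 : -(1 / 2) < a) (h1 : a < 1 / 2) (t : ℝ) :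
    MemLp (fun x => incr a (-t) (-x)) 2 volume :=
  (memLp_incr h0 h1 (-t)).comp_measurePreserving (Measure.measurePreserving_neg volume)

end Cross

open Matrix

/-! ### From the process to scalar integrals -/

section Covariance

lemma integral_add_add_add {α : Type*} [MeasurableSpace α] {μ : Measure α} {f g h k : α → ℝ}
    (hf : Integrable f μ) (hg : Integrable g μ) (hh : Integrable h μ) (hk : Integrable k μ) :
    ∫ x, (f x + g x + h x + k x) ∂μ
      = ∫ x, f x ∂μ + ∫ x, g x ∂μ + ∫ x, h x ∂μ + ∫ x, k x ∂μ := by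
  rw [integral_add (f := fun x => f x + g x + h x) ((hf.add hg).add hh) hk,
    integral_add (f := fun x => f x + g x) (hf.add hg) hh, integral_add hf hg]

/-- Since `(t - x)_- = ((-t) - (-x))_+`, the negative part is the positive kernel reflected in both
variables. -/
lemma kernel_apply {p : ℕ} (H : Fin p → ℝ) (Ap Am : Matrix (Fin p) (Fin p) ℝ) (t x : ℝ)
    (i k : Fin p) :
    kernel H Ap Am t x i k
      = incr (H i - 1 / 2) t x * Ap i k + incr (H i - 1 / 2) (-t) (-x) * Am i k := by
  have e : -(t - x) = -t - -x := by ring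
  simp [kernel, incr, negPow, Matrix.diagonal_mul, e]

lemma memLp_kernel {p : ℕ} {H : Fin p → ℝ} (hH : ∀ i, 0 < H i ∧ H i < 1)
    (Ap Am : Matrix (Fin p) (Fin p) ℝ) (t : ℝ) (i k : Fin p) :
    MemLp (fun x => kernel H Ap Am t x i k) 2 volume := by
  simp_rw [kernel_apply]
  have h0 : -(1 / 2) < H i - 1 / 2 := by linarith [(hH i).1]
  have h1 : H i - 1 / 2 < 1 / 2 := by linarith [(hH i).2]
  exact ((memLp_incr h0 h1 t).mul_const _).add ((memLp_incr_reflect h0 h1 t).mul_const _)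

/-- The sum over `k` of the `L²` inner products of the kernels. -/
lemma sum_integral_kernel_mul_kernel {p : ℕ} {H : Fin p → ℝ} (hH : ∀ i, 0 < H i ∧ H i < 1)
    (Ap Am : Matrix (Fin p) (Fin p) ℝ) (s t : ℝ) (i j : Fin p) :
    ∑ k, ∫ x, kernel H Ap Am s x i k * kernel H Ap Am t x j k
      = (Ap * Apᵀ) i j * (∫ x, incr (H i - 1 / 2) s x * incr (H j - 1 / 2) t x)
        + (Am * Amᵀ) i j * (∫ x, incr (H i - 1 / 2) (-s) x * incr (H j - 1 / 2) (-t) x)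
        + (Ap * Amᵀ) i j * (∫ x, incr (H i - 1 / 2) s x * incr (H j - 1 / 2) (-t) (-x))
        + (Am * Apᵀ) i j * (∫ x, incr (H j - 1 / 2) t x * incr (H i - 1 / 2) (-s) (-x)) := by
  have hi0 : -(1 / 2) < H i - 1 / 2 := by linarith [(hH i).1]
  have hi1 : H i - 1 / 2 < 1 / 2 := by linarith [(hH i).2]
  have hj0 : -(1 / 2) < H j - 1 / 2 := by linarith [(hH j).1]
  have hj1 : H j - 1 / 2 < 1 / 2 := by linarith [(hH j).2]
  have I1 := integrable_mul_of_memLp_two (memLp_incr hi0 hi1 s) (memLp_incr hj0 hj1 t)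
  have I2 := integrable_mul_of_memLp_two (memLp_incr_reflect hi0 hi1 s)
    (memLp_incr_reflect hj0 hj1 t)
  have I3 := integrable_mul_of_memLp_two (memLp_incr hi0 hi1 s) (memLp_incr_reflect hj0 hj1 t)
  have I4 := integrable_mul_of_memLp_two (memLp_incr hj0 hj1 t) (memLp_incr_reflect hi0 hi1 s)
  rw [← integral_incr_reflect_mul_incr_reflect (H i - 1 / 2)]
  simp only [Matrix.mul_apply, Matrix.transpose_apply, Finset.sum_mul,
    ← Finset.sum_add_distrib]
  refine Finset.sum_congr rfl fun k _ => ?_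
  rw [← integral_const_mul, ← integral_const_mul, ← integral_const_mul, ← integral_const_mul,
    ← integral_add_add_add (I1.const_mul _) (I2.const_mul _) (I3.const_mul _) (I4.const_mul _)]
  congr 1 with x
  simp only [kernel_apply]
  ring

variable {Ω : Type*} [MeasurableSpace Ω] {P : Measure Ω} {p : ℕ} {W : Fin p → Set ℝ → Ω → ℝ}
  {H : Fin p → ℝ}

lemma IsGaussianWhiteNoise.isWienerIntegral_kernel (hW : IsGaussianWhiteNoise P W)
    (hH : ∀ i, 0 < H i ∧ H i < 1) (Ap Am : Matrix (Fin p) (Fin p) ℝ) (i k : Fin p) (t : ℝ) :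
    IsWienerIntegral P (W k) (fun x => kernel H Ap Am t x i k)
      (wienerIntegral P (W k) (fun x => kernel H Ap Am t x i k)) :=
  isWienerIntegral_wienerIntegral (hW.exists_isWienerIntegral k (memLp_kernel hH Ap Am t i k))

lemma IsGaussianWhiteNoise.memLp_vfbm (hW : IsGaussianWhiteNoise P W)
    (hH : ∀ i, 0 < H i ∧ H i < 1) (Ap Am : Matrix (Fin p) (Fin p) ℝ) (i : Fin p) (t : ℝ) :
    MemLp (vfbm P W H Ap Am i t) 2 P :=
  memLp_finsetSum _ fun k _ => (hW.isWienerIntegral_kernel hH Ap Am i k t).2.1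

lemma IsGaussianWhiteNoise.integral_vfbm [IsFiniteMeasure P] (hW : IsGaussianWhiteNoise P W)
    (hH : ∀ i, 0 < H i ∧ H i < 1) (Ap Am : Matrix (Fin p) (Fin p) ℝ) (i : Fin p) (t : ℝ) :
    ∫ ω, vfbm P W H Ap Am i t ω ∂P = 0 := by
  unfold vfbm
  rw [integral_finsetSum _ fun k _ =>
    (hW.isWienerIntegral_kernel hH Ap Am i k t).2.1.integrable one_le_two]
  exact Finset.sum_eq_zero fun k _ =>
    hW.integral_of_isWienerIntegral (hW.isWienerIntegral_kernel hH Ap Am i k t)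

lemma IsGaussianWhiteNoise.integral_vfbm_mul_vfbm (hW : IsGaussianWhiteNoise P W)
    (hH : ∀ i, 0 < H i ∧ H i < 1) (Ap Am : Matrix (Fin p) (Fin p) ℝ) (i j : Fin p) (s t : ℝ) :
    ∫ ω, vfbm P W H Ap Am i s ω * vfbm P W H Ap Am j t ω ∂P
      = ∑ k, ∫ x, kernel H Ap Am s x i k * kernel H Ap Am t x j k := by
  have hI := fun i k t => hW.isWienerIntegral_kernel hH Ap Am i k t
  unfold vfbm
  simp_rw [Finset.sum_mul_sum]
  have hint : ∀ k l : Fin p, Integrable (fun ω =>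
      wienerIntegral P (W k) (fun x => kernel H Ap Am s x i k) ω *
        wienerIntegral P (W l) (fun x => kernel H Ap Am t x j l) ω) P := fun k l =>
    integrable_mul_of_memLp_two (hI i k s).2.1 (hI j l t).2.1
  rw [integral_finsetSum _ fun k _ => integrable_finsetSum _ fun l _ => hint k l]
  refine Finset.sum_congr rfl fun k _ => ?_
  rw [integral_finsetSum _ fun l _ => hint k l]
  simp_rw [hW.integral_mul_of_isWienerIntegral (hI i k s) (hI j _ t)]
  simp

end Covariance

/-! ### Closed forms and degenerate coefficients -/

section ClosedForm

variable {p : ℕ} {H : Fin p → ℝ}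

/-- One-sided powers are the terms in which all four scalar integrals are expressed, so the
covariance formula reduces to comparing coefficients. -/
lemma signCoef_mul_abs_rpow (c : Matrix (Fin p) (Fin p) ℝ) (i j : Fin p) (t : ℝ) {h : ℝ}
    (hh : h ≠ 0) :
    signCoef c i j t * |t| ^ h = c i j * posPow t h + c j i * posPow (-t) h := by
  unfold signCoef
  rcases lt_trichotomy t 0 with ht | ht | ht
  · rw [if_neg (by linarith), posPow_of_nonpos ht.le, posPow_of_pos (neg_pos.2 ht), abs_of_neg ht]
    ring
  · simp [ht, posPow_of_nonpos, Real.zero_rpow hh]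
  · rw [if_pos ht, posPow_of_pos ht, posPow_of_nonpos (neg_nonpos.2 ht.le), abs_of_pos ht]
    ring

/-- The coefficients of the covariance in the case `H i + H j ≠ 1`. -/
def covCoef (H : Fin p → ℝ) (Ap Am : Matrix (Fin p) (Fin p) ℝ) : Matrix (Fin p) (Fin p) ℝ :=
  fun i j => beta (H i + 1 / 2) (H j + 1 / 2) / Real.sin ((H i + H j) * Real.pi) *
    ((Ap * Apᵀ) i j * Real.cos (H i * Real.pi) + (Am * Amᵀ) i j * Real.cos (H j * Real.pi)
      - (Ap * Amᵀ) i j * Real.sin ((H i + H j) * Real.pi))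

/-- The coefficients of the linear terms of the covariance in the case `H i + H j = 1`. -/
def covLinCoef (H : Fin p → ℝ) (Ap Am : Matrix (Fin p) (Fin p) ℝ) : Matrix (Fin p) (Fin p) ℝ :=
  fun i j => beta (H i + 1 / 2) (H j + 1 / 2) *
    ((Real.sin (H i * Real.pi) + Real.sin (H j * Real.pi)) / 2 *
      ((Ap * Apᵀ) i j + (Am * Amᵀ) i j) - (Ap * Amᵀ) i j - (Am * Apᵀ) i j)

/-- The coefficients of the logarithmic terms of the covariance in the case `H i + H j = 1`. -/
def covLogCoef (H : Fin p → ℝ) (Ap Am : Matrix (Fin p) (Fin p) ℝ) : Matrix (Fin p) (Fin p) ℝ :=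
  fun i j => (H j - H i) * ((Ap * Apᵀ) i j - (Am * Amᵀ) i j)

lemma mul_transpose_apply_comm (A B : Matrix (Fin p) (Fin p) ℝ) (i j : Fin p) :
    (A * Bᵀ) i j = (B * Aᵀ) j i := by
  simp [Matrix.mul_apply, mul_comm]

lemma sin_add_mul_pi_ne_zero {x y : ℝ} (hx : 0 < x ∧ x < 1) (hy : 0 < y ∧ y < 1)
    (hxy : x + y ≠ 1) : Real.sin ((x + y) * Real.pi) ≠ 0 := by
  have := sin_pi_mul_ne_zero (x := x + y - 1) (by linarith) (by linarith) (sub_ne_zero.2 hxy)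
  rwa [mul_sub, mul_one, Real.sin_sub_pi, neg_ne_zero, mul_comm] at this

lemma sin_pi_mul_sub_half (x : ℝ) : Real.sin (Real.pi * (x - 1 / 2)) = -Real.cos (x * Real.pi) := by
  rw [← Real.sin_sub_pi_div_two]
  ring_nf

lemma cos_pi_mul_sub_half (x : ℝ) : Real.cos (Real.pi * (x - 1 / 2)) = Real.sin (x * Real.pi) := by
  rw [← Real.cos_sub_pi_div_two]
  ring_nf

lemma covariance_eq_of_ne_one (hH : ∀ i, 0 < H i ∧ H i < 1) (Ap Am : Matrix (Fin p) (Fin p) ℝ)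
    {i j : Fin p} (hij : H i + H j ≠ 1) (s t : ℝ) :
    ∑ k, ∫ x, kernel H Ap Am s x i k * kernel H Ap Am t x j k
      = signCoef (covCoef H Ap Am) i j s * |s| ^ (H i + H j)
        + signCoef (covCoef H Ap Am) j i t * |t| ^ (H i + H j)
        - signCoef (covCoef H Ap Am) j i (t - s) * |t - s| ^ (H i + H j) := by
  have hi := hH i
  have hj := hH j
  have hh : H i + H j ≠ 0 := by linarith [hi.1, hj.1]
  have hsin := sin_add_mul_pi_ne_zero hi hj hij
  rw [sum_integral_kernel_mul_kernel hH, signCoef_mul_abs_rpow _ _ _ _ hh,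
    signCoef_mul_abs_rpow _ _ _ _ hh, signCoef_mul_abs_rpow _ _ _ _ hh,
    integral_incr_mul_incr (by linarith) (by linarith) (by linarith) (by linarith)
      (fun h => hij (by linarith)),
    integral_incr_mul_incr (by linarith) (by linarith) (by linarith) (by linarith)
      (fun h => hij (by linarith)),
    integral_incr_mul_incr_reflect (by linarith) (by linarith),
    integral_incr_mul_incr_reflect (by linarith) (by linarith)]
  have e1 : H i - 1 / 2 + (H j - 1 / 2) + 1 = H i + H j := by ring
  have e2 : H j - 1 / 2 + (H i - 1 / 2) + 1 = H i + H j := by ring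
  have e3 : H i - 1 / 2 + 1 = H i + 1 / 2 := by ring
  have e4 : H j - 1 / 2 + 1 = H j + 1 / 2 := by ring
  have e5 : -t - -s = s - t := by ring
  have e6 : Real.pi * (H i + H j) = (H i + H j) * Real.pi := by ring
  simp only [regProd, regBeta, covCoef, e1, e2, e3, e4, e5, e6, neg_neg, neg_sub,
    sin_pi_mul_sub_half, add_comm (H j) (H i), beta_comm (H j + 1 / 2) (H i + 1 / 2),
    mul_transpose_apply_comm Ap Ap j i, mul_transpose_apply_comm Am Am j i,
    mul_transpose_apply_comm Ap Am j i]
  generalize Real.sin ((H i + H j) * Real.pi) = S at hsin ⊢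
  field_simp
  ring

lemma covariance_eq_of_eq_one (hH : ∀ i, 0 < H i ∧ H i < 1) (Ap Am : Matrix (Fin p) (Fin p) ℝ)
    {i j : Fin p} (hij : H i + H j = 1) (s t : ℝ) :
    ∑ k, ∫ x, kernel H Ap Am s x i k * kernel H Ap Am t x j k
      = 1 / 2 * (covLinCoef H Ap Am i j * (|s| + |t| - |s - t|)
        + covLogCoef H Ap Am i j *
          (t * Real.log |t| - s * Real.log |s| - (t - s) * Real.log |t - s|)) := by
  have hi := hH i
  have hj := hH j
  have e0 : H j - 1 / 2 = -(H i - 1 / 2) := by linarith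
  rw [sum_integral_kernel_mul_kernel hH, integral_incr_mul_incr_reflect (by linarith) (by linarith),
    integral_incr_mul_incr_reflect (by linarith) (by linarith), e0,
    integral_incr_mul_incr_neg_exponent (by linarith) (by linarith),
    integral_incr_mul_incr_neg_exponent (by linarith) (by linarith)]
  -- The linear halves cancel in the mixed integrals, leaving only absolute values.
  have hp : ∀ y : ℝ, posPow y 1 = (y + |y|) / 2 := by
    intro y
    have h1 := signed_posPow_one y
    have h2 := posPow_add_posPow_neg one_ne_zero y
    rw [Real.rpow_one] at h2
    linarith
  have e1 : H i - 1 / 2 + -(H i - 1 / 2) + 1 = 1 := by ring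
  have e2 : -(H i - 1 / 2) + (H i - 1 / 2) + 1 = 1 := by ring
  have e3 : H i - 1 / 2 + 1 = H i + 1 / 2 := by ring
  have e4 : -(H i - 1 / 2) + 1 = H j + 1 / 2 := by linarith
  have e5 : -t - -s = -(t - s) := by ring
  have e6 : Real.sin (H j * Real.pi) = Real.sin (H i * Real.pi) := by
    rw [← Real.sin_pi_sub]
    congr 1
    linear_combination (-Real.pi) * hij
  have e7 : H j = 1 - H i := by linarith
  simp only [covLinCoef, covLogCoef, e1, e2, e3, e4, e5, e6, hp, cos_pi_mul_sub_half, abs_neg,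
    beta_comm (H j + 1 / 2) (H i + 1 / 2), abs_sub_comm t s]
  rw [e7]
  ring

/-- Time `t = 1` gives `c i j + c j i = 0`; subtracting this from `t = 2` gives `c j i * (2 ^ h - 2)
= 0`, where `2 ^ h ≠ 2`. -/
lemma covCoef_eq_zero {c : Matrix (Fin p) (Fin p) ℝ} {i j : Fin p} {h : ℝ} (h1 : h ≠ 1)
    (h0 : ∀ t : ℝ, signCoef c i j 1 * |(1 : ℝ)| ^ h + signCoef c j i t * |t| ^ h
      - signCoef c j i (t - 1) * |t - 1| ^ h = 0) (hh : h ≠ 0) : c i j = 0 ∧ c j i = 0 := by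
  have a1 := h0 1
  have a2 := h0 2
  have e : (2 : ℝ) - 1 = 1 := by norm_num
  rw [e] at a2
  simp only [signCoef, sub_self, abs_zero, Real.zero_rpow hh, zero_lt_one, if_true, abs_one,
    Real.one_rpow, zero_lt_two, abs_two] at a1 a2
  have h2 : (2 : ℝ) ^ h - 2 ≠ 0 := by
    intro h2
    have : (2 : ℝ) ^ h = 2 ^ (1 : ℝ) := by rw [Real.rpow_one]; linarith
    exact h1 ((Real.rpow_right_inj (by norm_num) (by norm_num)).1 this)
  have h3 : c j i * ((2 : ℝ) ^ h - 2) = 0 := by linear_combination a2 - a1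
  have h4 : c j i = 0 := (mul_eq_zero.1 h3).resolve_right h2
  rw [h4] at a1
  exact ⟨by linarith, h4⟩

/-- At `t = 1` all logarithmic terms vanish and `d = 0` remains; then `t = 2` leaves `f * log 2 =
0`. -/
lemma covLinCoef_covLogCoef_eq_zero {d f : ℝ}
    (h0 : ∀ t : ℝ, 1 / 2 * (d * (|(1 : ℝ)| + |t| - |1 - t|)
        + f * (t * Real.log |t| - 1 * Real.log |(1 : ℝ)| - (t - 1) * Real.log |t - 1|)) = 0) :
    d = 0 ∧ f = 0 := by
  have a1 := h0 1
  have a2 := h0 2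
  have e : (2 : ℝ) - 1 = 1 := by norm_num
  have e' : |(1 : ℝ) - 2| = 1 := by norm_num
  rw [e, e'] at a2
  simp only [sub_self, abs_zero, abs_one, Real.log_one, abs_two, mul_zero, sub_zero] at a1 a2
  have hd : d = 0 := by linarith
  have hl := Real.log_pos one_lt_two
  rw [hd] at a2
  refine ⟨hd, ?_⟩
  have : f * Real.log 2 = 0 := by linarith
  exact (mul_eq_zero.1 this).resolve_right hl.ne'

lemma covariance_one_one (hH : ∀ i, 0 < H i ∧ H i < 1) (Ap Am : Matrix (Fin p) (Fin p) ℝ)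
    (i : Fin p) :
    ∑ k, ∫ x, kernel H Ap Am 1 x i k * kernel H Ap Am 1 x i k
      = beta (H i + 1 / 2) (H i + 1 / 2) / Real.sin (H i * Real.pi) *
        ((Ap * Apᵀ) i i + (Am * Amᵀ) i i - 2 * Real.sin (H i * Real.pi) * (Ap * Amᵀ) i i) := by
  have hi := hH i
  by_cases h : H i + H i = 1
  · rw [covariance_eq_of_eq_one hH Ap Am h]
    have hs : Real.sin (H i * Real.pi) = 1 := by
      rw [← Real.sin_pi_div_two]
      congr 1
      linear_combination Real.pi / 2 * h
    simp only [covLinCoef, covLogCoef, hs, mul_transpose_apply_comm Am Ap i i]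
    simp
    ring
  · rw [covariance_eq_of_ne_one hH Ap Am h]
    have hsin := sin_add_mul_pi_ne_zero hi hi h
    have e : (H i + H i) * Real.pi = 2 * (H i * Real.pi) := by ring
    have hh : H i + H i ≠ 0 := by linarith
    simp only [signCoef, covCoef, ite_self, sub_self, abs_zero, Real.zero_rpow hh, abs_one,
      Real.one_rpow, mul_zero, sub_zero, mul_one]
    rw [e, Real.sin_two_mul] at hsin ⊢
    have h1 : Real.sin (H i * Real.pi) ≠ 0 := fun h => hsin (by rw [h]; ring)
    have h2 : Real.cos (H i * Real.pi) ≠ 0 := fun h => hsin (by rw [h]; ring)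
    field_simp
    ring

end ClosedForm

end VFBM

end

/-! ### Assembly and normalization by `σ_i σ_j` -/

open VFBM Matrix in
theorem proposition3p1 {Ω : Type*} [MeasurableSpace Ω] (P : Measure Ω) [IsProbabilityMeasure P]
    {p : ℕ} (W : Fin p → Set ℝ → Ω → ℝ) (hW : IsGaussianWhiteNoise P W)
    (H : Fin p → ℝ) (hH : ∀ i, 0 < H i ∧ H i < 1)
    (Ap Am : Matrix (Fin p) (Fin p) ℝ)
    (X : Fin p → ℝ → Ω → ℝ) (hX : ∀ i t, X i t =ᵐ[P] vfbm P W H Ap Am i t)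
    (σ : Fin p → ℝ) (hσ : ∀ i, σ i = √(variance (X i 1) P)) :
    -- the Wiener integrals exist, and `X` is a centered second-order process
    (∀ i k t, ∃ Y, IsWienerIntegral P (W k) (fun x => kernel H Ap Am t x i k) Y) ∧
    (∀ i t, MemLp (X i t) 2 P ∧ ∫ ω, X i t ω ∂P = 0) ∧
    -- (i)
    (∀ i, variance (X i 1) P =
      beta (H i + 1 / 2) (H i + 1 / 2) / Real.sin (H i * Real.pi) *
        ((Ap * Apᵀ) i i + (Am * Amᵀ) i i - 2 * Real.sin (H i * Real.pi) * (Ap * Amᵀ) i i)) ∧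
    -- (ii)
    (∃ c : Matrix (Fin p) (Fin p) ℝ, ∀ i j, H i + H j ≠ 1 →
      σ i * σ j / 2 * c i j =
        beta (H i + 1 / 2) (H j + 1 / 2) / Real.sin ((H i + H j) * Real.pi) *
          ((Ap * Apᵀ) i j * Real.cos (H i * Real.pi) + (Am * Amᵀ) i j * Real.cos (H j * Real.pi)
            - (Ap * Amᵀ) i j * Real.sin ((H i + H j) * Real.pi)) ∧
      ∀ s t : ℝ, ∫ ω, X i s ω * X j t ω ∂P =
        σ i * σ j / 2 *
          (signCoef c i j s * |s| ^ (H i + H j) + signCoef c j i t * |t| ^ (H i + H j)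
            - signCoef c j i (t - s) * |t - s| ^ (H i + H j))) ∧
    -- (iii)
    (∃ d f : Matrix (Fin p) (Fin p) ℝ, ∀ i j, H i + H j = 1 →
      σ i * σ j * d i j =
        beta (H i + 1 / 2) (H j + 1 / 2) *
          ((Real.sin (H i * Real.pi) + Real.sin (H j * Real.pi)) / 2 *
              ((Ap * Apᵀ) i j + (Am * Amᵀ) i j)
            - (Ap * Amᵀ) i j - (Am * Apᵀ) i j) ∧
      σ i * σ j * f i j = (H j - H i) * ((Ap * Apᵀ) i j - (Am * Amᵀ) i j) ∧
      ∀ s t : ℝ, ∫ ω, X i s ω * X j t ω ∂P =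
        σ i * σ j / 2 *
          (d i j * (|s| + |t| - |s - t|)
            + f i j * (t * Real.log |t| - s * Real.log |s| - (t - s) * Real.log |t - s|))) := by
  have hL : ∀ i t, MemLp (X i t) 2 P := fun i t =>
    (memLp_congr_ae (hX i t)).2 (hW.memLp_vfbm hH Ap Am i t)
  have hmean : ∀ i t, ∫ ω, X i t ω ∂P = 0 := fun i t => by
    rw [integral_congr_ae (hX i t), hW.integral_vfbm hH]
  have hcov : ∀ i j s t, ∫ ω, X i s ω * X j t ω ∂P
      = ∑ k, ∫ x, kernel H Ap Am s x i k * kernel H Ap Am t x j k := fun i j s t =>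
    (integral_congr_ae ((hX i s).mul (hX j t))).trans
      (hW.integral_vfbm_mul_vfbm hH Ap Am i j s t)
  have hvar : ∀ i, variance (X i 1) P = ∫ ω, X i 1 ω * X i 1 ω ∂P := fun i => by
    rw [variance_of_integral_eq_zero (hL i 1).1.aemeasurable (hmean i 1)]
    simp_rw [sq]
  -- Zero variance and zero mean make `X_i(1)` vanish almost surely.
  have hdeg : ∀ i j t, σ i = 0 → ∫ ω, X i 1 ω * X j t ω ∂P = 0 := by
    intro i j t h
    rw [hσ, Real.sqrt_eq_zero (variance_nonneg _ _), hvar,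
      integral_eq_zero_iff_of_nonneg (fun ω => mul_self_nonneg _)
        (integrable_mul_of_memLp_two (hL i 1) (hL i 1))] at h
    refine (integral_congr_ae ?_).trans (integral_zero _ _)
    filter_upwards [h] with ω hω
    rw [mul_self_eq_zero.1 hω, zero_mul]
  have hC : ∀ i j, H i + H j ≠ 1 → σ i * σ j = 0 → covCoef H Ap Am i j = 0 := by
    have key : ∀ i j, H i + H j ≠ 1 → σ i = 0 →
        covCoef H Ap Am i j = 0 ∧ covCoef H Ap Am j i = 0 := by
      intro i j hij h
      refine covCoef_eq_zero hij (fun t => ?_) (by linarith [(hH i).1, (hH j).1])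
      rw [← covariance_eq_of_ne_one hH Ap Am hij, ← hcov, hdeg i j t h]
    intro i j hij h
    rcases mul_eq_zero.1 h with h | h
    · exact (key i j hij h).1
    · exact (key j i (by rwa [add_comm]) h).2
  have hD : ∀ i j, H i + H j = 1 → σ i * σ j = 0 →
      covLinCoef H Ap Am i j = 0 ∧ covLogCoef H Ap Am i j = 0 := by
    have key : ∀ i j, H i + H j = 1 → σ i = 0 →
        covLinCoef H Ap Am i j = 0 ∧ covLogCoef H Ap Am i j = 0 := by
      intro i j hij h
      refine covLinCoef_covLogCoef_eq_zero fun t => ?_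
      rw [← covariance_eq_of_eq_one hH Ap Am hij, ← hcov, hdeg i j t h]
    intro i j hij h
    rcases mul_eq_zero.1 h with h | h
    · exact key i j hij h
    · have h' := key j i (by rwa [add_comm]) h
      -- When `σ j = 0`, indices are exchanged: the linear coefficient is symmetric in `i, j`, the
      -- logarithmic one antisymmetric.
      constructor
      · rw [← h'.1]
        simp only [covLinCoef, beta_comm (H j + 1 / 2) (H i + 1 / 2),
          mul_transpose_apply_comm Ap Ap j i, mul_transpose_apply_comm Am Am j i,
          mul_transpose_apply_comm Ap Am j i, mul_transpose_apply_comm Am Ap j i]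
        ring
      · rw [← neg_eq_zero, ← h'.2]
        simp only [covLogCoef, mul_transpose_apply_comm Ap Ap j i,
          mul_transpose_apply_comm Am Am j i]
        ring
  refine ⟨fun i k t => hW.exists_isWienerIntegral k (memLp_kernel hH Ap Am t i k),
    fun i t => ⟨hL i t, hmean i t⟩, fun i => ?_, ?_, ?_⟩
  · rw [hvar, hcov, covariance_one_one hH]
  -- If `σ i * σ j = 0`, the quotient is 0 by convention, consistent with `covCoef` vanishing there
  -- by `hC`.
  · refine ⟨fun i j => 2 / (σ i * σ j) * covCoef H Ap Am i j, fun i j hij => ?_⟩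
    have hscale : ∀ i j, H i + H j ≠ 1 →
        σ i * σ j / 2 * (2 / (σ i * σ j) * covCoef H Ap Am i j) = covCoef H Ap Am i j := by
      intro i j hij
      by_cases h : σ i * σ j = 0
      · rw [hC i j hij h, mul_zero, mul_zero]
      · have hi := left_ne_zero_of_mul h
        have hj := right_ne_zero_of_mul h
        field_simp
    have hs := hscale i j hij
    have hs' := hscale j i (by rwa [add_comm])
    rw [mul_comm (σ j)] at hs'
    have hsign : ∀ t : ℝ, σ i * σ j / 2 *
          signCoef (fun i j => 2 / (σ i * σ j) * covCoef H Ap Am i j) i j t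
          = signCoef (covCoef H Ap Am) i j t := by
      intro t
      simp only [signCoef, mul_comm (σ j)]
      split_ifs <;> assumption
    have hsign' : ∀ t : ℝ, σ i * σ j / 2 *
          signCoef (fun i j => 2 / (σ i * σ j) * covCoef H Ap Am i j) j i t
          = signCoef (covCoef H Ap Am) j i t := by
      intro t
      simp only [signCoef, mul_comm (σ j)]
      split_ifs <;> assumption
    refine ⟨hs, fun s t => ?_⟩
    rw [hcov, covariance_eq_of_ne_one hH Ap Am hij, ← hsign, ← hsign', ← hsign']
    ring
  · refine ⟨fun i j => covLinCoef H Ap Am i j / (σ i * σ j),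
      fun i j => covLogCoef H Ap Am i j / (σ i * σ j), fun i j hij => ?_⟩
    have h1 : σ i * σ j * (covLinCoef H Ap Am i j / (σ i * σ j)) = covLinCoef H Ap Am i j := by
      by_cases h : σ i * σ j = 0
      · rw [(hD i j hij h).1, zero_div, mul_zero]
      · have hi := left_ne_zero_of_mul h
        have hj := right_ne_zero_of_mul h
        field_simp
    have h2 : σ i * σ j * (covLogCoef H Ap Am i j / (σ i * σ j)) = covLogCoef H Ap Am i j := by
      by_cases h : σ i * σ j = 0
      · rw [(hD i j hij h).2, zero_div, mul_zero]
      · have hi := left_ne_zero_of_mul h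
        have hj := right_ne_zero_of_mul h
        field_simp
    refine ⟨h1, h2, fun s t => ?_⟩
    rw [hcov, covariance_eq_of_eq_one hH Ap Am hij]
    linear_combination (-1 / 2 * (|s| + |t| - |s - t|)) * h1
      - 1 / 2 * (t * Real.log |t| - s * Real.log |s| - (t - s) * Real.log |t - s|) * h2
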